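/- **Setting.** A *signature* $\Theta$ is a set of propositional letters. A *$\Theta$-model* $\mathcal M=(W,\prec,V)$ is a nonempty partially ordered set $(W,\prec)$ with a valuation $V$ assigning to each $p\in\Theta$ an up-closed subset $V(p)\subseteq W$; a *pointed* model is a pair $(\mathcal M,w)$ with $w\in W$. Bi-intuitionistic propositional logic $\mathsf{BIL}$ has the connectives $\bot,\wedge,\vee,\to,\ll$, with the usual Kripke clauses for $\bot,\wedge,\vee$, and $w\models\varphi\to\psi$ iff every $v\succ w$ has $v\not\models\varphi$ or $v\models\psi$; $w\models\varphi\ll\psi$ iff some $v\prec w$ has $v\models\varphi$ and $v\not\models\psi$ (here $\prec$ is reflexive). An *abstract bi-intuitionistic logic* $\mathcal L$ assigns to each signature $\Theta$ a set $L(\Theta)$ of formulas, monotonically in $\Theta$, with a satisfaction relation between pointed $\Theta$-models and formulas in $L(\Theta)$, such that: satisfaction is invariant under isomorphism; for $\Theta\subseteq\Theta'$, satisfaction of $\varphi\in L(\Theta)$ in a $\Theta'$-model depends only on its $\Theta$-reduct; for each formula $\varphi\in L(\Theta)$ there is a finite $\Theta_\varphi\subseteq\Theta$ such that $\varphi\in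 L(\Theta')$ iff $\Theta_\varphi\subseteq\Theta'$; and each $L(\Theta)$ contains $\bot$ and is closed under $\wedge,\vee,\to,\ll$, with the semantics above. $\mathcal L$ *extends* $\mathsf{BIL}$ if every $\mathsf{BIL}$-formula of signature $\Theta$ is equivalent over all pointed $\Theta$-models to some formula in $L(\Theta)$. For a pointed $\Theta$-model, $Th_{\mathcal L}(\mathcal M,w)=(\{\varphi\in L(\Theta):\mathcal M,w\models\varphi\},\{\varphi\in L(\Theta):\mathcal M,w\not\models\varphi\})$, with first component $Th^+_{\mathcal L}(\mathcal M,w)$; inclusion of pairs of sets is componentwise. We write $\mathcal M\preccurlyeq_{\mathcal L}\mathcal N$ if $\mathcal M$ is a submodel of $\mathcal N$ and $Th_{\mathcal L}(\mathcal M,v)=Th_{\mathcal L}(\mathcal N,v)$ for all worlds $v$ of $\mathcal M$. A *bi-asimulation* from $(\mathcal M_1,w_1)$ to $(\mathcal M_2,w_2)$ is a relation $A\subseteq(W_1\times W_2)\cup(W_2\times W_1)$ with $w_1Aw_2$ such that for $\{i,j\}=\{1,2\}$: if $vAs$ with $v\in W_i$, $s\in W_j$, then (a) $v\in V_i(p)$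 implies $s\in V_j(p)$ for all $p\in\Theta$; (b) if $s\prec_j t$, there is $u\in W_i$ with $v\prec_i u$, $tAu$, $uAt$; (c) if $u\prec_i v$, there is $t\in W_j$ with $t\prec_j s$, $tAu$, $uAt$. The logic $\mathcal L$ * is *preserved under bi-asimulations* if the existence of a bi-asimulation from $(\mathcal M_1,w_1)$ to $(\mathcal M_2,w_2)$ implies $Th^+_{\mathcal L}(\mathcal M_1,w_1)\subseteq Th^+_{\mathcal L}(\mathcal M_2,w_2)$; * is *$\star$-compact* if for all $\Theta$ and $\Gamma,\Delta\subseteq L(\Theta)$: whenever for all finite $\Gamma'\subseteq\Gamma$, $\Delta'\subseteq\Delta$ there is a pointed $\Theta$-model with $(\Gamma',\Delta')\subseteq Th_{\mathcal L}(\mathcal M,w)$, there is one with $(\Gamma,\Delta)\subseteq Th_{\mathcal L}(\mathcal M,w)$; * has the *Tarski Union Property (TUP)* if for every chain $\mathcal M_0\preccurlyeq_{\mathcal L}\mathcal M_1\preccurlyeq_{\mathcal L}\cdots$ one has $\mathcal M_n\preccurlyeq_{\mathcal L}\bigcup_k\mathcal M_k$ for all $n$. For $\Gamma,\Delta\subseteq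 L(\Theta)$, the pair $(\Gamma,\Delta)$ is a *successor* (resp. *predecessor*) *$\mathcal L$-type* of $(\mathcal M,v)$ if for all finite $\Gamma'\subseteq\Gamma$, $\Delta'\subseteq\Delta$ some $u\succ v$ (resp. $u\prec v$) in $\mathcal M$ has $(\Gamma',\Delta')\subseteq Th_{\mathcal L}(\mathcal M,u)$. A model $\mathcal N\succcurlyeq_{\mathcal L}\mathcal M$ *realizes* it if some $u$ in $\mathcal N$ with $v\prec u$ (resp. $u\prec v$) in $\mathcal N$ has $(\Gamma,\Delta)\subseteq Th_{\mathcal L}(\mathcal N,u)$. A model is *$\mathcal L$-saturated* if it realizes all successor and predecessor $\mathcal L$-types of $(\mathcal N,v)$, for every world $v$ of it. The *bi-unravelling* $\mathcal M^{un}_w$ of $\mathcal M$ around $w$ has as worlds the finite sequences $(u_1,\dots,u_n)$, $n\ge1$, of worlds of $\mathcal M$ with $u_1=w$ and with $u_i\neq u_{i+1}$ and $u_i\prec u_{i+1}$ or $u_{i+1}\prec u_i$ for all $i<n$. Its order is the reflexive transitive closure of the relation relating $(u_1,\dots,u_n)$ to $(u_1,\dots,u_{n+1})$ when $u_n\prec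 u_{n+1}$, and $(u_1,\dots,u_{n+1})$ to $(u_1,\dots,u_n)$ when $u_{n+1}\prec u_n$; and $(u_1,\dots,u_n)$ lies in the valuation of $p$ iff $u_n\in V(p)$. **Statement.** Let $\mathcal L$ be an abstract bi-intuitionistic logic that extends $\mathsf{BIL}$, is preserved under bi-asimulations, is $\star$-compact and has the TUP. Let $(\mathcal M,w)$ be a pointed $\Theta$-model. Then there is a pointed $\Theta$-model $(\mathcal N,w')$ such that $$Th_{\mathcal L}(\mathcal M,w)=Th_{\mathcal L}(\mathcal N,w')\quad\text{and}\quad\mathcal N\text{ is }\mathcal L\text{-saturated}.$$ Moreover, $\mathcal N$ can be chosen to be the union of a chain $\mathcal N_0\preccurlyeq_{\mathcal L}\mathcal N_1\preccurlyeq_{\mathcal L}\cdots$ of $\Theta$-models such that $\mathcal N_0$ is isomorphic to the bi-unravelling $\mathcal M^{un}_w$ by an isomorphism taking the one-term sequence $(w)$ to $w'$, and $\mathcal N_{n+1}$ realizes every $\mathcal L$-type of $\mathcal N_n$ for every $n$. -/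

import Mathlib

universe u v v'

namespace BiInt

/-- Propositional letters are drawn from a proper class (relative to `Type u`): every set may serve
as a letter. -/
abbrev Letter : Type (u + 1) := ZFSet.{u}

/-- A signature is an arbitrary *set* (that is, a `u`-small collection) of letters. -/
structure Signature : Type (u + 1) where
  letters : Set Letter.{u}
  small : Small.{u} letters

/-- A (bi-intuitionistic) Kripke model of signature `Θ`: a nonempty partially ordered set of worlds
with an upward closed valuation of the letters in `Θ`. -/
structure Model (Θ : Signature.{u}) where
  World : Type u
  nonempty : Nonempty World
  rel : World → World → Prop
  rel_refl : ∀ x, rel x x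
  rel_trans : ∀ x y z, rel x y → rel y z → rel x z
  rel_antisymm : ∀ x y, rel x y → rel y x → x = y
  val : Θ.letters → Set World
  val_mono : ∀ (p : Θ.letters) (x y : World), rel x y → x ∈ val p → y ∈ val p

namespace Model

/-- The reduct `M ↾ Θ` of a `Θ'`-model to a smaller signature `Θ ⊆ Θ'`. -/
def reduct {Θ Θ' : Signature.{u}} (h : Θ.letters ⊆ Θ'.letters) (M : Model Θ') : Model Θ where
  World := M.World
  nonempty := M.nonempty
  rel := M.rel
  rel_refl := M.rel_refl
  rel_trans := M.rel_trans
  rel_antisymm := M.rel_antisymm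
  val := fun p => M.val ⟨p.1, h p.2⟩
  val_mono := fun p => M.val_mono ⟨p.1, h p.2⟩

/-- The submodel `M(S)` of `M` whose set of worlds is the nonempty set `S`. -/
def submodel {Θ : Signature.{u}} (M : Model Θ) (S : Set M.World) (hS : S.Nonempty) : Model Θ where
  World := S
  nonempty := hS.to_subtype
  rel := fun x y => M.rel x.1 y.1
  rel_refl := fun x => M.rel_refl x.1
  rel_trans := fun x y z => M.rel_trans x.1 y.1 z.1
  rel_antisymm := fun x y h h' => Subtype.ext (M.rel_antisymm x.1 y.1 h h')
  val := fun p => {x | x.1 ∈ M.val p}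
  val_mono := fun p x y => M.val_mono p x.1 y.1

/-- Isomorphisms of `Θ`-models. -/
structure Iso {Θ : Signature.{u}} (M N : Model Θ) extends M.World ≃ N.World where
  rel_iff : ∀ x y : M.World, M.rel x y ↔ N.rel (toFun x) (toFun y)
  val_iff : ∀ (p : Θ.letters) (x : M.World), x ∈ M.val p ↔ toFun x ∈ N.val p

/-- `g` identifies `M` with a submodel of `N` (it plays the role of the inclusion `M ⊆ N`). -/
structure IsInclusion {Θ : Signature.{u}} (M N : Model Θ) (g : M.World → N.World) : Prop where
  injective : Function.Injective g
  rel_iff : ∀ x y, M.rel x y ↔ N.rel (g x) (g y)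
  val_iff : ∀ (p : Θ.letters) (x : M.World), x ∈ M.val p ↔ g x ∈ N.val p

/-- The sets `W 0 ⊆ W 1 ⊆ …` are nonempty and exhaust the worlds of `N`; equivalently, the submodels
`N(W 0) ⊆ N(W 1) ⊆ …` form an `ω`-chain of models and `N` is the union of this chain. -/
structure IsUnionOfChain {Θ : Signature.{u}} (N : Model Θ) (W : ℕ → Set N.World) : Prop where
  nonempty : ∀ n, (W n).Nonempty
  mono : ∀ n, W n ⊆ W (n + 1)
  covers : ⋃ n, W n = Set.univ

/-! ### Bi-unravellings -/

/-- Two worlds may be adjacent in a bi-unravelling if they are comparable and distinct. -/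
def Adjacent {Θ : Signature.{u}} (M : Model Θ) (x y : M.World) : Prop :=
  (M.rel x y ∨ M.rel y x) ∧ x ≠ y

/-- Worlds of the bi-unravelling around `w`: finite sequences starting at `w` in which consecutive
members are comparable and distinct. The list `l` encodes the sequence `w :: l`. -/
def UnravelWorld {Θ : Signature.{u}} (M : Model Θ) (w : M.World) : Type u :=
  {l : List M.World // List.IsChain M.Adjacent (w :: l)}

/-- The last member of a sequence. -/
def UnravelWorld.last {Θ : Signature.{u}} {M : Model Θ} {w : M.World} (s : UnravelWorld M w) :
    M.World :=
  (w :: s.1).getLast (List.cons_ne_nil _ _)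

/-- One step of the order of the bi-unravelling: either `t` prolongs `s` by a successor of the last
member of `s`, or `s` prolongs `t` by a predecessor of the last member of `t`. -/
def UnravelStep {Θ : Signature.{u}} (M : Model Θ) (w : M.World) (s t : UnravelWorld M w) : Prop :=
  (∃ b, t.1 = s.1 ++ [b] ∧ M.rel s.last b) ∨ (∃ b, s.1 = t.1 ++ [b] ∧ M.rel b t.last)

theorem UnravelWorld.last_append {Θ : Signature.{u}} {M : Model Θ} {w : M.World}
    {s t : UnravelWorld M w} {b : M.World} (h : t.1 = s.1 ++ [b]) :
    t.last = b ∧ s.last ≠ b := by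
  have ht := t.2
  constructor
  · unfold UnravelWorld.last
    simp [h]
  · rw [h, ← List.cons_append, List.isChain_append] at ht
    exact (ht.2.2 s.last (by
      rw [UnravelWorld.last, List.getLast?_eq_some_getLast (List.cons_ne_nil _ _)]
      exact Option.mem_some_self _) b (by simp)).2

theorem UnravelStep.lt {Θ : Signature.{u}} {M : Model Θ} {w : M.World} {s t : UnravelWorld M w}
    (h : UnravelStep M w s t) : M.rel s.last t.last ∧ s.last ≠ t.last := by
  rcases h with ⟨b, hb, hr⟩ | ⟨b, hb, hr⟩
  · obtain ⟨h1, h2⟩ := UnravelWorld.last_append hb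
    rw [h1]
    exact ⟨hr, h2⟩
  · obtain ⟨h1, h2⟩ := UnravelWorld.last_append hb
    rw [h1]
    exact ⟨hr, h2.symm⟩

theorem UnravelStep.le_of_reflTransGen {Θ : Signature.{u}} {M : Model Θ} {w : M.World}
    {s t : UnravelWorld M w} (h : Relation.ReflTransGen (UnravelStep M w) s t) :
    M.rel s.last t.last := by
  induction h with
  | refl => exact M.rel_refl _
  | tail _ h2 ih => exact M.rel_trans _ _ _ ih h2.lt.1

theorem UnravelStep.antisymm {Θ : Signature.{u}} {M : Model Θ} {w : M.World}
    {s t : UnravelWorld M w} (h : Relation.ReflTransGen (UnravelStep M w) s t)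
    (h' : Relation.ReflTransGen (UnravelStep M w) t s) : s = t := by
  rcases Relation.ReflTransGen.cases_head h with h0 | ⟨r, hsr, hrt⟩
  · exact h0
  · exact absurd (M.rel_antisymm _ _ hsr.lt.1
      (UnravelStep.le_of_reflTransGen (hrt.trans h'))) hsr.lt.2

/-- The bi-unravelling of `M` around `w`. -/
def unravel {Θ : Signature.{u}} (M : Model Θ) (w : M.World) : Model Θ where
  World := UnravelWorld M w
  nonempty := ⟨⟨[], List.isChain_singleton w⟩⟩
  rel := Relation.ReflTransGen (UnravelStep M w)
  rel_refl := fun _ => Relation.ReflTransGen.refl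
  rel_trans := fun _ _ _ h h' => h.trans h'
  rel_antisymm := fun _ _ h h' => UnravelStep.antisymm h h'
  val := fun p => {s | s.last ∈ M.val p}
  val_mono := fun p _ _ h hs => M.val_mono p _ _ (UnravelStep.le_of_reflTransGen h) hs

/-- The one-member sequence `w`, as a world of the bi-unravelling around `w`. -/
def unravelRoot {Θ : Signature.{u}} (M : Model Θ) (w : M.World) : (M.unravel w).World :=
  (⟨[], List.isChain_singleton w⟩ : UnravelWorld M w)

end Model

/-! ### Bi-asimulations -/

/-- The clauses on a bi-asimulation for one of the two directions; `A` is its part in `W₁ × W₂`,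
`B` its part in `W₂ × W₁`. -/
structure HalfBiasimulation {Θ : Signature.{u}} (M₁ M₂ : Model Θ)
    (A : M₁.World → M₂.World → Prop) (B : M₂.World → M₁.World → Prop) : Prop where
  atom : ∀ (x : M₁.World) (s : M₂.World) (p : Θ.letters), A x s → x ∈ M₁.val p → s ∈ M₂.val p
  back : ∀ (x : M₁.World) (s t : M₂.World), A x s → M₂.rel s t → ∃ y, M₁.rel x y ∧ B t y ∧ A y t
  forth : ∀ (x y : M₁.World) (s : M₂.World), A x s → M₁.rel y x → ∃ t, M₂.rel t s ∧ B t y ∧ A y t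

/-- Bi-asimulations from `(M₁, w₁)` to `(M₂, w₂)`. A relation included in
`(W₁ × W₂) ∪ (W₂ × W₁)` is given by its two parts `A` and `B`. -/
structure IsBiasimulation {Θ : Signature.{u}} (M₁ : Model Θ) (w₁ : M₁.World)
    (M₂ : Model Θ) (w₂ : M₂.World)
    (A : M₁.World → M₂.World → Prop) (B : M₂.World → M₁.World → Prop) : Prop where
  elem : A w₁ w₂
  left : HalfBiasimulation M₁ M₂ A B
  right : HalfBiasimulation M₂ M₁ B A

/-! ### Abstract bi-intuitionistic logics -/

/-- An abstract bi-intuitionistic logic. `Sat M w φ` is meaningful only if `φ` is a formula of the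
signature of `M`; its values elsewhere are unconstrained and are never used. -/
structure AbstractLogic where
  /-- The class in which all formulas live. -/
  Form : Type v
  /-- The set `L(Θ)` of formulas of signature `Θ`. -/
  formulas : Signature.{u} → Set Form
  formulas_small : ∀ Θ, Small.{u} (formulas Θ)
  Sat : {Θ : Signature.{u}} → (M : Model Θ) → M.World → Form → Prop
  mono : ∀ Θ Θ' : Signature.{u}, Θ.letters ⊆ Θ'.letters → formulas Θ ⊆ formulas Θ'
  isomorphism : ∀ (Θ : Signature.{u}) (M N : Model Θ) (f : M.Iso N) (w : M.World),
    ∀ φ ∈ formulas Θ, (Sat M w φ ↔ Sat N (f.toFun w) φ)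
  expansion : ∀ (Θ Θ' : Signature.{u}) (h : Θ.letters ⊆ Θ'.letters) (M : Model Θ') (w : M.World),
    ∀ φ ∈ formulas Θ, (Sat M w φ ↔ Sat (M.reduct h) w φ)
  occurrence : ∀ (Θ : Signature.{u}), ∀ φ ∈ formulas Θ,
    ∃ F : Set Letter.{u}, F.Finite ∧ F ⊆ Θ.letters ∧
      ∀ Θ' : Signature.{u}, φ ∈ formulas Θ' ↔ F ⊆ Θ'.letters
  bot : Form
  and : Form → Form → Form
  or : Form → Form → Form
  imp : Form → Form → Form
  coimp : Form → Form → Form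
  bot_mem : ∀ Θ, bot ∈ formulas Θ
  and_mem : ∀ Θ, ∀ φ ∈ formulas Θ, ∀ ψ ∈ formulas Θ, and φ ψ ∈ formulas Θ
  or_mem : ∀ Θ, ∀ φ ∈ formulas Θ, ∀ ψ ∈ formulas Θ, or φ ψ ∈ formulas Θ
  imp_mem : ∀ Θ, ∀ φ ∈ formulas Θ, ∀ ψ ∈ formulas Θ, imp φ ψ ∈ formulas Θ
  coimp_mem : ∀ Θ, ∀ φ ∈ formulas Θ, ∀ ψ ∈ formulas Θ, coimp φ ψ ∈ formulas Θ
  sat_bot : ∀ (Θ : Signature.{u}) (M : Model Θ) (w : M.World), ¬ Sat M w bot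
  sat_and : ∀ (Θ : Signature.{u}) (M : Model Θ) (w : M.World),
    ∀ φ ∈ formulas Θ, ∀ ψ ∈ formulas Θ, (Sat M w (and φ ψ) ↔ Sat M w φ ∧ Sat M w ψ)
  sat_or : ∀ (Θ : Signature.{u}) (M : Model Θ) (w : M.World),
    ∀ φ ∈ formulas Θ, ∀ ψ ∈ formulas Θ, (Sat M w (or φ ψ) ↔ Sat M w φ ∨ Sat M w ψ)
  sat_imp : ∀ (Θ : Signature.{u}) (M : Model Θ) (w : M.World),
    ∀ φ ∈ formulas Θ, ∀ ψ ∈ formulas Θ,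
      (Sat M w (imp φ ψ) ↔ ∀ x, M.rel w x → ¬ Sat M x φ ∨ Sat M x ψ)
  sat_coimp : ∀ (Θ : Signature.{u}) (M : Model Θ) (w : M.World),
    ∀ φ ∈ formulas Θ, ∀ ψ ∈ formulas Θ,
      (Sat M w (coimp φ ψ) ↔ ∃ x, M.rel x w ∧ Sat M x φ ∧ ¬ Sat M x ψ)

namespace AbstractLogic

/-- The `L(Θ)`-theory of the pointed model `(M, w)`: the set of formulas true at `w`, paired with the
set of formulas that fail at `w`. Pairs of sets are compared by `≤`, i.e. componentwise inclusion. -/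
def Th (L : AbstractLogic.{u, v}) {Θ : Signature.{u}} (M : Model Θ) (w : M.World) :
    Set L.Form × Set L.Form :=
  ({φ | φ ∈ L.formulas Θ ∧ L.Sat M w φ}, {φ | φ ∈ L.formulas Θ ∧ ¬ L.Sat M w φ})

/-- `L'` extends `L`: each formula of `L` is equivalent to a formula of `L'` of the same signature. -/
def IsExtendedBy (L : AbstractLogic.{u, v}) (L' : AbstractLogic.{u, v'}) : Prop :=
  ∀ Θ : Signature.{u}, ∀ φ ∈ L.formulas Θ, ∃ ψ ∈ L'.formulas Θ,
    ∀ (M : Model Θ) (w : M.World), L.Sat M w φ ↔ L'.Sat M w ψ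

/-- Preservation under bi-asimulations. -/
def PreservedUnderBiasimulations (L : AbstractLogic.{u, v}) : Prop :=
  ∀ (Θ : Signature.{u}) (M₁ : Model Θ) (w₁ : M₁.World) (M₂ : Model Θ) (w₂ : M₂.World)
    (A : M₁.World → M₂.World → Prop) (B : M₂.World → M₁.World → Prop),
    IsBiasimulation M₁ w₁ M₂ w₂ A B → (L.Th M₁ w₁).1 ⊆ (L.Th M₂ w₂).1

/-- The theory `(Γ, Δ)` is satisfied at some pointed `Θ`-model. -/
def Satisfiable (L : AbstractLogic.{u, v}) (Θ : Signature.{u}) (Γ Δ : Set L.Form) : Prop :=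
  ∃ (M : Model Θ) (w : M.World), (Γ, Δ) ≤ L.Th M w

/-- `⋆`-compactness. -/
def StarCompact (L : AbstractLogic.{u, v}) : Prop :=
  ∀ (Θ : Signature.{u}) (Γ Δ : Set L.Form), Γ ⊆ L.formulas Θ → Δ ⊆ L.formulas Θ →
    (∀ Γ' ⊆ Γ, ∀ Δ' ⊆ Δ, Γ'.Finite → Δ'.Finite → L.Satisfiable Θ Γ' Δ') →
    L.Satisfiable Θ Γ Δ

/-- `M` is an `L`-elementary submodel of `N`, where `g` plays the role of the inclusion. -/
def ElementarySubmodel (L : AbstractLogic.{u, v}) {Θ : Signature.{u}} (M N : Model Θ)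
    (g : M.World → N.World) : Prop :=
  M.IsInclusion N g ∧ ∀ w, L.Th M w = L.Th N (g w)

/-- `N(W 0) ≼ N(W 1) ≼ …` is an `L`-elementary `ω`-chain of models with union `N`. -/
def IsUnionOfElementaryChain (L : AbstractLogic.{u, v}) {Θ : Signature.{u}} (N : Model Θ)
    (W : ℕ → Set N.World) (h : N.IsUnionOfChain W) : Prop :=
  ∀ n, L.ElementarySubmodel (N.submodel (W n) (h.nonempty n))
    (N.submodel (W (n + 1)) (h.nonempty (n + 1))) (Set.inclusion (h.mono n))

/-- The Tarski Union Property: each member of an `L`-elementary `ω`-chain is an `L`-elementary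
submodel of the union of the chain. -/
def TarskiUnionProperty (L : AbstractLogic.{u, v}) : Prop :=
  ∀ (Θ : Signature.{u}) (N : Model Θ) (W : ℕ → Set N.World) (h : N.IsUnionOfChain W),
    L.IsUnionOfElementaryChain N W h →
    ∀ n, L.ElementarySubmodel (N.submodel (W n) (h.nonempty n)) N Subtype.val

/-- `(Γ, Δ)` is a successor `L`-type of `(M, w)`. -/
def IsSuccessorType (L : AbstractLogic.{u, v}) {Θ : Signature.{u}} (M : Model Θ) (w : M.World)
    (Γ Δ : Set L.Form) : Prop :=
  Γ ⊆ L.formulas Θ ∧ Δ ⊆ L.formulas Θ ∧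
    ∀ Γ' ⊆ Γ, ∀ Δ' ⊆ Δ, Γ'.Finite → Δ'.Finite → ∃ x, M.rel w x ∧ (Γ', Δ') ≤ L.Th M x

/-- `(Γ, Δ)` is a predecessor `L`-type of `(M, w)`. -/
def IsPredecessorType (L : AbstractLogic.{u, v}) {Θ : Signature.{u}} (M : Model Θ) (w : M.World)
    (Γ Δ : Set L.Form) : Prop :=
  Γ ⊆ L.formulas Θ ∧ Δ ⊆ L.formulas Θ ∧
    ∀ Γ' ⊆ Γ, ∀ Δ' ⊆ Δ, Γ'.Finite → Δ'.Finite → ∃ x, M.rel x w ∧ (Γ', Δ') ≤ L.Th M x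

/-- `N` realizes every `L`-type of `M`, where `g` plays the role of the inclusion of `M` in `N`. -/
def RealizesTypesOf (L : AbstractLogic.{u, v}) {Θ : Signature.{u}} (N M : Model Θ)
    (g : M.World → N.World) : Prop :=
  ∀ (w : M.World) (Γ Δ : Set L.Form),
    (L.IsSuccessorType M w Γ Δ → ∃ x, N.rel (g w) x ∧ (Γ, Δ) ≤ L.Th N x) ∧
    (L.IsPredecessorType M w Γ Δ → ∃ x, N.rel x (g w) ∧ (Γ, Δ) ≤ L.Th N x)

/-- `M` is `L`-saturated: it realizes all of its own `L`-types. -/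
def Saturated (L : AbstractLogic.{u, v}) {Θ : Signature.{u}} (M : Model Θ) : Prop :=
  L.RealizesTypesOf M M id

end AbstractLogic

/-! ### Bi-intuitionistic propositional logic -/

/-- Formulas of bi-intuitionistic propositional logic over a collection `P` of letters. -/
inductive Formula (P : Type v) : Type v
  | atom : P → Formula P
  | bot : Formula P
  | and : Formula P → Formula P → Formula P
  | or : Formula P → Formula P → Formula P
  | imp : Formula P → Formula P → Formula P
  | coimp : Formula P → Formula P → Formula P

namespace Formula

/-- The set of letters that occur in a formula. -/
def letters {P : Type v} : Formula P → Set P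
  | atom p => {p}
  | bot => ∅
  | and φ ψ => φ.letters ∪ ψ.letters
  | or φ ψ => φ.letters ∪ ψ.letters
  | imp φ ψ => φ.letters ∪ ψ.letters
  | coimp φ ψ => φ.letters ∪ ψ.letters

/-- Kripke semantics. -/
def Sat {Θ : Signature.{u}} (M : Model Θ) : M.World → Formula Letter.{u} → Prop
  | w, atom p => ∃ h : p ∈ Θ.letters, w ∈ M.val ⟨p, h⟩
  | _, bot => False
  | w, and φ ψ => Sat M w φ ∧ Sat M w ψ
  | w, or φ ψ => Sat M w φ ∨ Sat M w ψ
  | w, imp φ ψ => ∀ x, M.rel w x → ¬ Sat M x φ ∨ Sat M x ψ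
  | w, coimp φ ψ => ∃ x, M.rel x w ∧ Sat M x φ ∧ ¬ Sat M x ψ

/-- Renaming of letters. -/
def map {P : Type v} {Q : Type v'} (f : P → Q) : Formula P → Formula Q
  | atom p => atom (f p)
  | bot => bot
  | and φ ψ => and (φ.map f) (ψ.map f)
  | or φ ψ => or (φ.map f) (ψ.map f)
  | imp φ ψ => imp (φ.map f) (ψ.map f)
  | coimp φ ψ => coimp (φ.map f) (ψ.map f)

theorem finite_letters {P : Type v} (φ : Formula P) : φ.letters.Finite := by
  induction φ with
  | atom p => exact Set.finite_singleton p
  | bot => exact Set.finite_empty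
  | and _ _ h h' => exact h.union h'
  | or _ _ h h' => exact h.union h'
  | imp _ _ h h' => exact h.union h'
  | coimp _ _ h h' => exact h.union h'

theorem exists_map_eq {P : Type v} {Q : Type v'} (f : P → Q) (φ : Formula Q)
    (h : φ.letters ⊆ Set.range f) : ∃ φ' : Formula P, φ'.map f = φ := by
  induction φ with
  | atom q =>
    obtain ⟨p, hp⟩ := h (Set.mem_singleton q)
    exact ⟨atom p, by rw [map, hp]⟩
  | bot => exact ⟨bot, rfl⟩
  | and φ ψ ih ih' =>
    obtain ⟨a, ha⟩ := ih (Set.subset_union_left.trans h)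
    obtain ⟨b, hb⟩ := ih' (Set.subset_union_right.trans h)
    exact ⟨and a b, by rw [map, ha, hb]⟩
  | or φ ψ ih ih' =>
    obtain ⟨a, ha⟩ := ih (Set.subset_union_left.trans h)
    obtain ⟨b, hb⟩ := ih' (Set.subset_union_right.trans h)
    exact ⟨or a b, by rw [map, ha, hb]⟩
  | imp φ ψ ih ih' =>
    obtain ⟨a, ha⟩ := ih (Set.subset_union_left.trans h)
    obtain ⟨b, hb⟩ := ih' (Set.subset_union_right.trans h)
    exact ⟨imp a b, by rw [map, ha, hb]⟩
  | coimp φ ψ ih ih' =>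
    obtain ⟨a, ha⟩ := ih (Set.subset_union_left.trans h)
    obtain ⟨b, hb⟩ := ih' (Set.subset_union_right.trans h)
    exact ⟨coimp a b, by rw [map, ha, hb]⟩

theorem small_formulas (Θ : Signature.{u}) :
    Small.{u} {φ : Formula Letter.{u} | φ.letters ⊆ Θ.letters} := by
  have := Θ.small
  let f : Shrink.{u} Θ.letters → Letter.{u} := fun p => ((equivShrink Θ.letters).symm p).1
  have hf : Θ.letters ⊆ Set.range f := fun p hp =>
    ⟨equivShrink Θ.letters ⟨p, hp⟩, by simp [f]⟩
  exact small_subset (s := Set.range (map f)) fun φ hφ => exists_map_eq f φ (Set.Subset.trans hφ hf)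

theorem sat_iso {Θ : Signature.{u}} {M N : Model Θ} (f : M.Iso N) (φ : Formula Letter.{u}) :
    ∀ w, Sat M w φ ↔ Sat N (f.toFun w) φ := by
  induction φ with
  | atom p => exact fun w => exists_congr fun h => f.val_iff ⟨p, h⟩ w
  | bot => exact fun _ => Iff.rfl
  | and φ ψ ih ih' => exact fun w => and_congr (ih w) (ih' w)
  | or φ ψ ih ih' => exact fun w => or_congr (ih w) (ih' w)
  | imp φ ψ ih ih' =>
    exact fun w => f.toEquiv.forall_congr fun x =>
      imp_congr (f.rel_iff w x) (or_congr (not_congr (ih x)) (ih' x))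
  | coimp φ ψ ih ih' =>
    exact fun w => f.toEquiv.exists_congr fun x =>
      and_congr (f.rel_iff x w) (and_congr (ih x) (not_congr (ih' x)))

theorem sat_reduct {Θ Θ' : Signature.{u}} (hΘ : Θ.letters ⊆ Θ'.letters) (M : Model Θ')
    (φ : Formula Letter.{u}) (hφ : φ.letters ⊆ Θ.letters) :
    ∀ w : M.World, Sat M w φ ↔ Sat (M.reduct hΘ) w φ := by
  induction φ with
  | atom p =>
    have hp : p ∈ Θ.letters := hφ (Set.mem_singleton p)
    exact fun w => ⟨fun ⟨_, h⟩ => ⟨hp, h⟩, fun ⟨_, h⟩ => ⟨hΘ hp, h⟩⟩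
  | bot => exact fun _ => Iff.rfl
  | and φ ψ ih ih' =>
    replace ih := ih (Set.subset_union_left.trans hφ)
    replace ih' := ih' (Set.subset_union_right.trans hφ)
    exact fun w => and_congr (ih w) (ih' w)
  | or φ ψ ih ih' =>
    replace ih := ih (Set.subset_union_left.trans hφ)
    replace ih' := ih' (Set.subset_union_right.trans hφ)
    exact fun w => or_congr (ih w) (ih' w)
  | imp φ ψ ih ih' =>
    replace ih := ih (Set.subset_union_left.trans hφ)
    replace ih' := ih' (Set.subset_union_right.trans hφ)
    exact fun w => forall_congr' fun x =>
      imp_congr Iff.rfl (or_congr (not_congr (ih x)) (ih' x))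
  | coimp φ ψ ih ih' =>
    replace ih := ih (Set.subset_union_left.trans hφ)
    replace ih' := ih' (Set.subset_union_right.trans hφ)
    exact fun w => exists_congr fun x =>
      and_congr Iff.rfl (and_congr (ih x) (not_congr (ih' x)))

end Formula

/-- Bi-intuitionistic propositional logic as an abstract bi-intuitionistic logic. -/
def BIL : AbstractLogic.{u, u + 1} where
  Form := Formula Letter.{u}
  formulas := fun Θ => {φ | φ.letters ⊆ Θ.letters}
  formulas_small := Formula.small_formulas
  Sat := fun M w φ => Formula.Sat M w φ
  mono := fun _ _ h _ hφ => Set.Subset.trans hφ h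
  isomorphism := fun _ _ _ f w φ _ => Formula.sat_iso f φ w
  expansion := fun _ _ h M w φ hφ => Formula.sat_reduct h M φ hφ w
  occurrence := fun _ φ hφ => ⟨φ.letters, φ.finite_letters, hφ, fun _ => Iff.rfl⟩
  bot := Formula.bot
  and := Formula.and
  or := Formula.or
  imp := Formula.imp
  coimp := Formula.coimp
  bot_mem := fun _ => Set.empty_subset _
  and_mem := fun _ _ h _ h' => Set.union_subset h h'
  or_mem := fun _ _ h _ h' => Set.union_subset h h'
  imp_mem := fun _ _ h _ h' => Set.union_subset h h'
  coimp_mem := fun _ _ h _ h' => Set.union_subset h h'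
  sat_bot := fun _ _ _ h => h
  sat_and := fun _ _ _ _ _ _ _ => Iff.rfl
  sat_or := fun _ _ _ _ _ _ _ => Iff.rfl
  sat_imp := fun _ _ _ _ _ _ _ => Iff.rfl
  sat_coimp := fun _ _ _ _ _ _ _ => Iff.rfl

end BiInt

open BiInt

namespace BiInt

/-! ### Fresh letters -/

/-! The plan is the classical one: by `⋆`-compactness, the diagram of a model together with the
realizations its types demand has a model; iterating this `ω` times and taking the union, TUP gives
saturation. The obstacle is that no formula can name a world: valuations are up-closed, and nothing
forces a name to be borne only once.

A name is therefore a pair of letters, borne where the first is true and the second fails. In the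
intended expansion these denote the up-set of a world and the complement of its down-set, so only
that world bears the name. The diagram is written with such names (`sat_diagramFormula`) and made to
hold in a whole zigzag component by a box built from `imp` and `coimp`
(`StarCompact.exists_linked`). Compactness yields a model `K` in which many worlds may share a name,
so the original model need not embed in it. What is known: a world named `a` has the theory of `a`,
sees a world named `b` above or below it where the order requires one, and bears the name of no
other world of the original model.

This is enough if the original model is a bi-unravelling, hence a tree. Worlds of `K` are chosen
recursively along prolongations (`UnravelWorld.exists_tree_map`), and the path of choices is a world
of the bi-unravelling of `K`. Theories are unaffected, since taking the last member is a
bi-asimulation (`PreservedUnderBiasimulations.th_unravel`). The order of a bi-unravelling is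
generated by prolongations, so unwanted comparabilities of `K` between chosen worlds disappear
(`unravel_rel_iff`). The extension is again a bi-unravelling, so the construction can be repeated.
-/

theorem Signature.exists_fresh (Θ : Signature.{u}) (P : Type*) [Small.{u} P] :
    ∃ e : P → Letter.{u}, Function.Injective e ∧ ∀ a, e a ∉ Θ.letters := by
  rcases Function.Embedding.total P (Θ.lettersᶜ : Set Letter.{u}) with ⟨⟨f⟩⟩ | ⟨⟨f⟩⟩
  · exact ⟨fun a => (f a).1, Subtype.val_injective.comp f.injective, fun a => (f a).2⟩
  -- Otherwise the unused letters inject into `P` and form a small set; then all letters do, and so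
  -- do the ordinals, which is absurd.
  · have := Θ.small
    have : Small.{u} (Θ.lettersᶜ : Set Letter.{u}) := small_of_injective f.injective
    have : Small.{u} (Θ.letters ∪ Θ.lettersᶜ : Set Letter.{u}) := small_union _ _
    rw [Set.union_compl_self] at this
    have : Small.{u} Letter.{u} := small_of_injective (Equiv.Set.univ Letter.{u}).symm.injective
    have hinj : Function.Injective fun o : Ordinal.{u} => o.toZFSet := fun a b h => by
      rw [← Ordinal.rank_toZFSet a, ← Ordinal.rank_toZFSet b]
      exact congrArg ZFSet.rank h
    exact absurd (small_of_injective hinj) not_small_ordinal.{u, u}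

/-- The signature `Θ` with the letters `e a` added. -/
def Signature.extend (Θ : Signature.{u}) {P : Type*} [Small.{u} P] (e : P → Letter.{u}) :
    Signature.{u} where
  letters := Θ.letters ∪ Set.range e
  small := by
    have := Θ.small
    exact small_union _ _

theorem Signature.subset_extend (Θ : Signature.{u}) {P : Type*} [Small.{u} P]
    (e : P → Letter.{u}) : Θ.letters ⊆ (Θ.extend e).letters :=
  Set.subset_union_left

/-! ### Expansions by new letters and zigzag components -/

namespace Model

/-- A bijection between the worlds that respects order and valuation is an isomorphism. -/
def Iso.ofEquiv {Θ : Signature.{u}} {M N : Model Θ} (f : M.World ≃ N.World)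
    (h : ∀ x y, M.rel x y ↔ N.rel (f x) (f y))
    (h' : ∀ p x, x ∈ M.val p ↔ f x ∈ N.val p) : M.Iso N where
  toEquiv := f
  rel_iff := h
  val_iff := h'

/-- The expansion of a `Θ`-model in which the new letter `e a` denotes `V a`. -/
def expand {Θ : Signature.{u}} (M : Model Θ) {P : Type*} [Small.{u} P] (e : P → Letter.{u})
    (V : P → Set M.World) (hV : ∀ a x y, M.rel x y → x ∈ V a → y ∈ V a) :
    Model (Θ.extend e) where
  World := M.World
  nonempty := M.nonempty
  rel := M.rel
  rel_refl := M.rel_refl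
  rel_trans := M.rel_trans
  rel_antisymm := M.rel_antisymm
  val p := {x | (∃ h : p.1 ∈ Θ.letters, x ∈ M.val ⟨p.1, h⟩) ∨ ∃ a, e a = p.1 ∧ x ∈ V a}
  val_mono _ x y h hx := hx.imp (fun ⟨h0, h1⟩ => ⟨h0, M.val_mono _ x y h h1⟩)
    fun ⟨a, ha, h1⟩ => ⟨a, ha, hV a x y h h1⟩

theorem mem_expand_val {Θ : Signature.{u}} (M : Model Θ) {P : Type*} [Small.{u} P]
    {e : P → Letter.{u}} (he : Function.Injective e) (he' : ∀ a, e a ∉ Θ.letters)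
    (V : P → Set M.World) (hV : ∀ a x y, M.rel x y → x ∈ V a → y ∈ V a) (a : P)
    (h : e a ∈ (Θ.extend e).letters) (x : M.World) :
    x ∈ (M.expand e V hV).val ⟨e a, h⟩ ↔ x ∈ V a := by
  constructor
  · rintro (⟨h0, -⟩ | ⟨b, hb, hx⟩)
    · exact absurd h0 (he' a)
    · rwa [← he hb]
  · exact fun hx => Or.inr ⟨a, rfl, hx⟩

/-- A model is isomorphic to the reduct of any of its expansions. -/
def expandIso {Θ : Signature.{u}} (M : Model Θ) {P : Type*} [Small.{u} P]
    {e : P → Letter.{u}} (he' : ∀ a, e a ∉ Θ.letters)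
    (V : P → Set M.World) (hV : ∀ a x y, M.rel x y → x ∈ V a → y ∈ V a) :
    M.Iso ((M.expand e V hV).reduct (Θ.subset_extend e)) :=
  Iso.ofEquiv (Equiv.refl _) (fun _ _ => Iff.rfl) fun p x => by
    constructor
    · exact fun hx => Or.inl ⟨p.2, hx⟩
    · rintro (⟨_, h⟩ | ⟨a, ha, -⟩)
      · exact h
      · exact absurd p.2 (ha ▸ he' a)

/-- `x` and `y` are linked by a zigzag of comparable worlds. -/
def Linked {Θ : Signature.{u}} (M : Model Θ) : M.World → M.World → Prop :=
  Relation.ReflTransGen fun x y => M.rel x y ∨ M.rel y x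

end Model

/-! ### Formulas of an abstract logic -/

namespace AbstractLogic

variable (L : AbstractLogic.{u, v})

theorem th_eq_of_fst_eq {Θ : Signature.{u}} {M N : Model Θ} {x : M.World} {y : N.World}
    (h : (L.Th M x).1 = (L.Th N y).1) : L.Th M x = L.Th N y := by
  refine Prod.ext h (Set.ext fun φ => and_congr_right fun hφ => not_congr ?_)
  have := Set.ext_iff.1 h φ
  exact ⟨fun hs => (this.1 ⟨hφ, hs⟩).2, fun hs => (this.2 ⟨hφ, hs⟩).2⟩

theorem th_eq_iff {Θ : Signature.{u}} {M N : Model Θ} {x : M.World} {y : N.World} :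
    L.Th M x = L.Th N y ↔ ∀ φ ∈ L.formulas Θ, (L.Sat M x φ ↔ L.Sat N y φ) := by
  constructor
  · intro h φ hφ
    have := Set.ext_iff.1 (congrArg Prod.fst h) φ
    exact ⟨fun hs => (this.1 ⟨hφ, hs⟩).2, fun hs => (this.2 ⟨hφ, hs⟩).2⟩
  · exact fun h => L.th_eq_of_fst_eq (Set.ext fun φ => and_congr_right fun hφ => h φ hφ)

theorem th_le_iff {Θ : Signature.{u}} {M : Model Θ} {x : M.World} {Γ Δ : Set L.Form}
    (hΓ : Γ ⊆ L.formulas Θ) (hΔ : Δ ⊆ L.formulas Θ) :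
    (Γ, Δ) ≤ L.Th M x ↔ (∀ φ ∈ Γ, L.Sat M x φ) ∧ ∀ φ ∈ Δ, ¬ L.Sat M x φ :=
  ⟨fun h => ⟨fun _ hφ => (h.1 hφ).2, fun _ hφ => (h.2 hφ).2⟩,
    fun h => ⟨fun φ hφ => ⟨hΓ hφ, h.1 φ hφ⟩, fun φ hφ => ⟨hΔ hφ, h.2 φ hφ⟩⟩⟩

theorem th_iso {Θ : Signature.{u}} {M N : Model Θ} (f : M.Iso N) (x : M.World) :
    L.Th M x = L.Th N (f.toFun x) :=
  L.th_eq_iff.2 fun φ hφ => L.isomorphism Θ M N f x φ hφ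

/-- The true formula. -/
def top : L.Form := L.imp L.bot L.bot

theorem top_mem (Θ : Signature.{u}) : L.top ∈ L.formulas Θ :=
  L.imp_mem Θ _ (L.bot_mem Θ) _ (L.bot_mem Θ)

theorem sat_top {Θ : Signature.{u}} (M : Model Θ) (x : M.World) : L.Sat M x L.top :=
  (L.sat_imp Θ M x _ (L.bot_mem Θ) _ (L.bot_mem Θ)).2 fun y _ => Or.inl (L.sat_bot Θ M y)

/-- `φ` holds at all predecessors of all successors. -/
def box (φ : L.Form) : L.Form := L.imp (L.coimp L.top φ) L.bot

variable {L}

theorem box_mem {Θ : Signature.{u}} {φ : L.Form} (hφ : φ ∈ L.formulas Θ) :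
    L.box φ ∈ L.formulas Θ :=
  L.imp_mem Θ _ (L.coimp_mem Θ _ (L.top_mem Θ) _ hφ) _ (L.bot_mem Θ)

theorem sat_box {Θ : Signature.{u}} {φ : L.Form} (hφ : φ ∈ L.formulas Θ) (M : Model Θ)
    (x : M.World) : L.Sat M x (L.box φ) ↔ ∀ y, M.rel x y → ∀ z, M.rel z y → L.Sat M z φ := by
  rw [box, L.sat_imp Θ M x _ (L.coimp_mem Θ _ (L.top_mem Θ) _ hφ) _ (L.bot_mem Θ)]
  refine forall₂_congr fun y _ => ?_
  rw [L.sat_coimp Θ M y _ (L.top_mem Θ) _ hφ]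
  simp [L.sat_bot, L.sat_top]

theorem iterate_box_mem {Θ : Signature.{u}} {φ : L.Form} (hφ : φ ∈ L.formulas Θ) (n : ℕ) :
    L.box^[n] φ ∈ L.formulas Θ := by
  induction n with
  | zero => exact hφ
  | succ n ih => rw [Function.iterate_succ_apply']; exact box_mem ih

theorem sat_iterate_box {Θ : Signature.{u}} {φ : L.Form} (hφ : φ ∈ L.formulas Θ) {M : Model Θ}
    (h : ∀ x, L.Sat M x φ) (n : ℕ) (x : M.World) : L.Sat M x (L.box^[n] φ) := by
  induction n generalizing x with
  | zero => exact h x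
  | succ n ih =>
    rw [Function.iterate_succ_apply', sat_box (iterate_box_mem hφ n)]
    exact fun _ _ z _ => ih z

/-- Each zigzag step, up or down, is an up-then-down path with one half trivial, so it consumes one
`box`. The induction must therefore carry all iterates at once. -/
theorem sat_of_linked {Θ : Signature.{u}} {φ : L.Form} (hφ : φ ∈ L.formulas Θ) {M : Model Θ}
    {x y : M.World} (h : ∀ n, L.Sat M x (L.box^[n] φ)) (hxy : M.Linked x y) : L.Sat M y φ := by
  suffices ∀ n, L.Sat M y (L.box^[n] φ) from this 0
  induction hxy with
  | refl => exact h
  | @tail y z _ hyz ih =>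
    intro n
    have := ih (n + 1)
    rw [Function.iterate_succ_apply', sat_box (iterate_box_mem hφ n)] at this
    rcases hyz with hyz | hyz
    · exact this z hyz z (M.rel_refl z)
    · exact this y (M.rel_refl y) z hyz

/-- With its dual below, this turns a finite pair of sets into one formula to be true and one to
fail, which `imp` and `coimp` can then speak about. -/
theorem exists_conj {Θ : Signature.{u}} {Γ : Set L.Form} (hf : Γ.Finite)
    (hΓ : Γ ⊆ L.formulas Θ) : ∃ φ ∈ L.formulas Θ, ∀ (M : Model Θ) (x : M.World),
      L.Sat M x φ ↔ ∀ γ ∈ Γ, L.Sat M x γ := by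
  induction Γ, hf using Set.Finite.induction_on with
  | empty => exact ⟨L.top, L.top_mem Θ, fun M x => by simp [L.sat_top]⟩
  | @insert γ Γ _ _ ih =>
    obtain ⟨φ, hφ, h⟩ := ih ((Set.subset_insert _ _).trans hΓ)
    have hγ := hΓ (Set.mem_insert γ Γ)
    refine ⟨L.and γ φ, L.and_mem Θ _ hγ _ hφ, fun M x => ?_⟩
    rw [L.sat_and Θ M x _ hγ _ hφ, h, Set.forall_mem_insert]

theorem exists_disj {Θ : Signature.{u}} {Δ : Set L.Form} (hf : Δ.Finite)
    (hΔ : Δ ⊆ L.formulas Θ) : ∃ φ ∈ L.formulas Θ, ∀ (M : Model Θ) (x : M.World),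
      ¬ L.Sat M x φ ↔ ∀ δ ∈ Δ, ¬ L.Sat M x δ := by
  induction Δ, hf using Set.Finite.induction_on with
  | empty => exact ⟨L.bot, L.bot_mem Θ, fun M x => by simp [L.sat_bot]⟩
  | @insert δ Δ _ _ ih =>
    obtain ⟨φ, hφ, h⟩ := ih ((Set.subset_insert _ _).trans hΔ)
    have hδ := hΔ (Set.mem_insert δ Δ)
    refine ⟨L.or δ φ, L.or_mem Θ _ hδ _ hφ, fun M x => ?_⟩
    rw [L.sat_or Θ M x _ hδ _ hφ, not_or, h, Set.forall_mem_insert]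

/-- A finite piece of a theory is realized in a successor according to the theory of a world. -/
theorem exists_succ_of_th_eq {Θ : Signature.{u}} {M N : Model Θ} {x : M.World} {y : N.World}
    (h : L.Th M x = L.Th N y) {Γ Δ : Set L.Form} (hΓ : Γ ⊆ L.formulas Θ)
    (hΔ : Δ ⊆ L.formulas Θ) (hΓf : Γ.Finite) (hΔf : Δ.Finite)
    (hy : ∃ z, N.rel y z ∧ (Γ, Δ) ≤ L.Th N z) : ∃ z, M.rel x z ∧ (Γ, Δ) ≤ L.Th M z := by
  obtain ⟨φ, hφ, hφ'⟩ := exists_conj hΓf hΓ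
  obtain ⟨ψ, hψ, hψ'⟩ := exists_disj hΔf hΔ
  -- The implication fails at a world exactly when some successor satisfies all of `Γ` and refutes
  -- all of `Δ`.
  have key := L.th_eq_iff.1 h _ (L.imp_mem Θ _ hφ _ hψ)
  rw [L.sat_imp Θ M x _ hφ _ hψ, L.sat_imp Θ N y _ hφ _ hψ, ← not_iff_not] at key
  push Not at key
  obtain ⟨z, hz, hz'⟩ := hy
  rw [L.th_le_iff hΓ hΔ, ← hφ', ← hψ'] at hz'
  obtain ⟨z', h1, h2⟩ := key.2 ⟨z, hz, hz'⟩
  exact ⟨z', h1, by rwa [L.th_le_iff hΓ hΔ, ← hφ', ← hψ']⟩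

/-- A finite piece of a theory is realized in a predecessor according to the theory of a world. -/
theorem exists_pred_of_th_eq {Θ : Signature.{u}} {M N : Model Θ} {x : M.World} {y : N.World}
    (h : L.Th M x = L.Th N y) {Γ Δ : Set L.Form} (hΓ : Γ ⊆ L.formulas Θ)
    (hΔ : Δ ⊆ L.formulas Θ) (hΓf : Γ.Finite) (hΔf : Δ.Finite)
    (hy : ∃ z, N.rel z y ∧ (Γ, Δ) ≤ L.Th N z) : ∃ z, M.rel z x ∧ (Γ, Δ) ≤ L.Th M z := by
  obtain ⟨φ, hφ, hφ'⟩ := exists_conj hΓf hΓ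
  obtain ⟨ψ, hψ, hψ'⟩ := exists_disj hΔf hΔ
  have key := L.th_eq_iff.1 h _ (L.coimp_mem Θ _ hφ _ hψ)
  rw [L.sat_coimp Θ M x _ hφ _ hψ, L.sat_coimp Θ N y _ hφ _ hψ] at key
  obtain ⟨z, hz, hz'⟩ := hy
  rw [L.th_le_iff hΓ hΔ, ← hφ', ← hψ'] at hz'
  obtain ⟨z', h1, h2⟩ := key.2 ⟨z, hz, hz'⟩
  exact ⟨z', h1, by rwa [L.th_le_iff hΓ hΔ, ← hφ', ← hψ']⟩

/-- Being a type is a condition on finite pieces, each decided by a formula. This lets types of a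
union descend to the members of the chain. -/
theorem IsSuccessorType.of_th_eq {Θ : Signature.{u}} {M N : Model Θ} {x : M.World} {y : N.World}
    {Γ Δ : Set L.Form} (ht : L.IsSuccessorType N y Γ Δ) (h : L.Th M x = L.Th N y) :
    L.IsSuccessorType M x Γ Δ :=
  ⟨ht.1, ht.2.1, fun Γ' hΓ' Δ' hΔ' hf hf' => exists_succ_of_th_eq h (hΓ'.trans ht.1)
    (hΔ'.trans ht.2.1) hf hf' (ht.2.2 Γ' hΓ' Δ' hΔ' hf hf')⟩

theorem IsPredecessorType.of_th_eq {Θ : Signature.{u}} {M N : Model Θ} {x : M.World}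
    {y : N.World} {Γ Δ : Set L.Form} (ht : L.IsPredecessorType N y Γ Δ)
    (h : L.Th M x = L.Th N y) : L.IsPredecessorType M x Γ Δ :=
  ⟨ht.1, ht.2.1, fun Γ' hΓ' Δ' hΔ' hf hf' => exists_pred_of_th_eq h (hΓ'.trans ht.1)
    (hΔ'.trans ht.2.1) hf hf' (ht.2.2 Γ' hΓ' Δ' hΔ' hf hf')⟩

theorem exists_atom (hExt : BIL.{u}.IsExtendedBy L) {Θ : Signature.{u}} {p : Letter.{u}}
    (hp : p ∈ Θ.letters) : ∃ φ ∈ L.formulas Θ, ∀ (M : Model Θ) (x : M.World),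
      L.Sat M x φ ↔ x ∈ M.val ⟨p, hp⟩ := by
  obtain ⟨φ, hφ, h⟩ := hExt Θ (Formula.atom p) (Set.singleton_subset_iff.2 hp)
  refine ⟨φ, hφ, fun M x => (h M x).symm.trans ?_⟩
  exact ⟨fun ⟨_, h⟩ => h, fun h => ⟨hp, h⟩⟩

theorem val_iff_of_th_eq (hExt : BIL.{u}.IsExtendedBy L) {Θ : Signature.{u}} {M N : Model Θ}
    {x : M.World} {y : N.World} (h : L.Th M x = L.Th N y) (p : Θ.letters) :
    x ∈ M.val p ↔ y ∈ N.val p := by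
  obtain ⟨φ, hφ, hφ'⟩ := exists_atom hExt p.2
  rw [← hφ' M x, ← hφ' N y]
  exact L.th_eq_iff.1 h φ hφ

/-- Compactness for theories that are valid in a zigzag component. -/
theorem StarCompact.exists_linked (hComp : L.StarCompact) {Θ : Signature.{u}} {φ ψ : L.Form}
    (hφ : φ ∈ L.formulas Θ) (hψ : ψ ∈ L.formulas Θ) {ι : Type*} (I : Set ι) (ax : ι → L.Form)
    (hax : ∀ i ∈ I, ax i ∈ L.formulas Θ)
    (h : ∀ S ⊆ I, S.Finite → ∃ (M : Model Θ) (k : M.World), L.Sat M k φ ∧ ¬ L.Sat M k ψ ∧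
      ∀ i ∈ S, ∀ x, L.Sat M x (ax i)) :
    ∃ (M : Model Θ) (k : M.World), L.Sat M k φ ∧ ¬ L.Sat M k ψ ∧
      ∀ i ∈ I, ∀ x, M.Linked k x → L.Sat M x (ax i) := by
  -- Validity throughout the component of a world becomes the truth, at that world, of all iterated
  -- boxes of the axioms.
  set Γ : Set L.Form := insert φ {γ | ∃ i ∈ I, ∃ n, γ = L.box^[n] (ax i)} with hΓdef
  have hΓ : Γ ⊆ L.formulas Θ := by
    rintro _ (rfl | ⟨i, hi, n, rfl⟩)
    · exact hφ
    · exact iterate_box_mem (hax i hi) n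
  have hΔ : {ψ} ⊆ L.formulas Θ := Set.singleton_subset_iff.2 hψ
  obtain ⟨M, k, hk⟩ := hComp Θ Γ {ψ} hΓ hΔ fun Γ' hΓ' Δ' hΔ' hf _ => by
    -- A finite part of `Γ` involves only finitely many axioms; `S` collects their indices, and is
    -- empty when `γ` is no iterated box.
    have hch : ∀ γ : L.Form, ∃ S ⊆ I, S.Finite ∧
        (γ ∈ Γ → γ = φ ∨ ∃ i ∈ S, ∃ n, γ = L.box^[n] (ax i)) := by
      intro γ
      by_cases hγ : ∃ i ∈ I, ∃ n, γ = L.box^[n] (ax i)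
      · obtain ⟨i, hi, n, hn⟩ := hγ
        exact ⟨{i}, Set.singleton_subset_iff.2 hi, Set.finite_singleton i,
          fun _ => Or.inr ⟨i, rfl, n, hn⟩⟩
      · exact ⟨∅, Set.empty_subset _, Set.finite_empty, fun h' => Or.inl (h'.resolve_right hγ)⟩
    choose S hS hSf hSγ using hch
    obtain ⟨M, k, h1, h2, h3⟩ := h (⋃ γ ∈ Γ', S γ) (Set.iUnion₂_subset fun γ _ => hS γ)
      (hf.biUnion fun γ _ => hSf γ)
    refine ⟨M, k, (L.th_le_iff (hΓ'.trans hΓ) (hΔ'.trans hΔ)).2 ⟨fun γ hγ => ?_, fun δ hδ => ?_⟩⟩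
    · rcases hSγ γ (hΓ' hγ) with rfl | ⟨i, hi, n, rfl⟩
      · exact h1
      · exact sat_iterate_box (hax i (hS _ hi)) (h3 i (Set.mem_biUnion hγ hi)) n k
    · rwa [Set.mem_singleton_iff.1 (hΔ' hδ)]
  rw [L.th_le_iff hΓ hΔ] at hk
  refine ⟨M, k, hk.1 φ (Set.mem_insert _ _), hk.2 ψ rfl, fun i hi x hx => ?_⟩
  exact sat_of_linked (hax i hi) (fun n => hk.1 _ (Set.mem_insert_of_mem _ ⟨i, hi, n, rfl⟩)) hx

end AbstractLogic

/-! ### Diagrams with names given by pairs of letters -/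

namespace AbstractLogic

variable {L : AbstractLogic.{u, v}}

/-- The requirements expressed by the diagram of a family of points. -/
inductive DiagramAxiom (P : Type*) (F : Type*)
  | pos (a : P) (φ : F)
  | neg (a : P) (φ : F)
  | up (a b : P)
  | down (a b : P)
  | ne (a b : P)

/-- The requirements imposed by theories `Γ`, `Δ` of the points, a relation `R` that the order has
to contain and a relation `D` that has to be mapped to inequality. -/
def diagramAxioms {P F : Type*} (Γ Δ : P → Set F) (R D : P → P → Prop) : Set (DiagramAxiom P F)
  | .pos a φ => φ ∈ Γ a
  | .neg a φ => φ ∈ Δ a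
  | .up a b => R a b
  | .down a b => R b a
  | .ne a b => D a b

/-- A requirement as a formula: a world is named `a` if `t a` holds and `f a` fails there. -/
def diagramFormula (L : AbstractLogic.{u, v}) {P : Type*} (t f : P → L.Form) :
    DiagramAxiom P L.Form → L.Form
  | .pos a φ => L.imp (t a) (L.or (f a) φ)
  | .neg a φ => L.imp (L.and (t a) φ) (f a)
  | .up a b => L.imp (L.and (t a) (L.imp (t b) (f b))) (f a)
  | .down a b => L.imp (t a) (L.or (f a) (L.coimp (t b) (f b)))
  | .ne a b => L.imp (L.and (t a) (t b)) (L.or (f a) (f b))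

/-- The meaning of a requirement at the world `x`; `I a x` says that `x` is named `a`. -/
def DiagramAxiom.Holds {P : Type*} {Θ : Signature.{u}} (L : AbstractLogic.{u, v}) (M : Model Θ)
    (I : P → M.World → Prop) (x : M.World) : DiagramAxiom P L.Form → Prop
  | .pos a φ => I a x → L.Sat M x φ
  | .neg a φ => I a x → ¬ L.Sat M x φ
  | .up a b => I a x → ∃ y, M.rel x y ∧ I b y
  | .down a b => I a x → ∃ y, M.rel y x ∧ I b y
  | .ne a b => I a x → ¬ I b x

theorem diagramFormula_mem {P : Type*} {Θ : Signature.{u}} {t f : P → L.Form}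
    (ht : ∀ a, t a ∈ L.formulas Θ) (hf : ∀ a, f a ∈ L.formulas Θ)
    {Γ Δ : P → Set L.Form} (hΓ : ∀ a, Γ a ⊆ L.formulas Θ) (hΔ : ∀ a, Δ a ⊆ L.formulas Θ)
    {R D : P → P → Prop} (i : DiagramAxiom P L.Form) (hi : i ∈ diagramAxioms Γ Δ R D) :
    L.diagramFormula t f i ∈ L.formulas Θ := by
  match i, hi with
  | .pos a φ, hi => exact L.imp_mem Θ _ (ht a) _ (L.or_mem Θ _ (hf a) _ (hΓ a hi))
  | .neg a φ, hi => exact L.imp_mem Θ _ (L.and_mem Θ _ (ht a) _ (hΔ a hi)) _ (hf a)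
  | .up a b, _ =>
    exact L.imp_mem Θ _ (L.and_mem Θ _ (ht a) _ (L.imp_mem Θ _ (ht b) _ (hf b))) _ (hf a)
  | .down a b, _ =>
    exact L.imp_mem Θ _ (ht a) _ (L.or_mem Θ _ (hf a) _ (L.coimp_mem Θ _ (ht b) _ (hf b)))
  | .ne a b, _ =>
    exact L.imp_mem Θ _ (L.and_mem Θ _ (ht a) _ (ht b)) _ (L.or_mem Θ _ (hf a) _ (hf b))

/-- Failure of `f a` is moved across the arrow to become part of the premise. The formula `t b → f
b` fails exactly when some successor is named `b`; the co-implication of `t b` and `f b` holds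
exactly when some predecessor is. -/
theorem sat_diagramFormula {P : Type*} {Θ : Signature.{u}} {t f : P → L.Form}
    (ht : ∀ a, t a ∈ L.formulas Θ) (hf : ∀ a, f a ∈ L.formulas Θ)
    {Γ Δ : P → Set L.Form} (hΓ : ∀ a, Γ a ⊆ L.formulas Θ) (hΔ : ∀ a, Δ a ⊆ L.formulas Θ)
    {R D : P → P → Prop} (M : Model Θ) (x : M.World)
    (i : DiagramAxiom P L.Form) (hi : i ∈ diagramAxioms Γ Δ R D) :
    L.Sat M x (L.diagramFormula t f i) ↔
      ∀ y, M.rel x y → i.Holds L M (fun a z => L.Sat M z (t a) ∧ ¬ L.Sat M z (f a)) y := by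
  match i, hi with
  | .pos a φ, hi =>
    rw [diagramFormula, L.sat_imp Θ M x _ (ht a) _ (L.or_mem Θ _ (hf a) _ (hΓ a hi))]
    refine forall₂_congr fun y _ => ?_
    rw [L.sat_or Θ M y _ (hf a) _ (hΓ a hi), DiagramAxiom.Holds]
    tauto
  | .neg a φ, hi =>
    rw [diagramFormula, L.sat_imp Θ M x _ (L.and_mem Θ _ (ht a) _ (hΔ a hi)) _ (hf a)]
    refine forall₂_congr fun y _ => ?_
    rw [L.sat_and Θ M y _ (ht a) _ (hΔ a hi), DiagramAxiom.Holds]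
    tauto
  | .up a b, _ =>
    have hi := L.imp_mem Θ _ (ht b) _ (hf b)
    rw [diagramFormula, L.sat_imp Θ M x _ (L.and_mem Θ _ (ht a) _ hi) _ (hf a)]
    refine forall₂_congr fun y _ => ?_
    rw [L.sat_and Θ M y _ (ht a) _ hi, DiagramAxiom.Holds, L.sat_imp Θ M y _ (ht b) _ (hf b)]
    have : (∃ z, M.rel y z ∧ L.Sat M z (t b) ∧ ¬ L.Sat M z (f b)) ↔
        ¬ ∀ z, M.rel y z → ¬ L.Sat M z (t b) ∨ L.Sat M z (f b) := by
      push Not; rfl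
    rw [this]
    tauto
  | .down a b, _ =>
    have hi := L.coimp_mem Θ _ (ht b) _ (hf b)
    rw [diagramFormula, L.sat_imp Θ M x _ (ht a) _ (L.or_mem Θ _ (hf a) _ hi)]
    refine forall₂_congr fun y _ => ?_
    rw [L.sat_or Θ M y _ (hf a) _ hi, DiagramAxiom.Holds, L.sat_coimp Θ M y _ (ht b) _ (hf b)]
    tauto
  | .ne a b, _ =>
    rw [diagramFormula, L.sat_imp Θ M x _ (L.and_mem Θ _ (ht a) _ (ht b)) _
      (L.or_mem Θ _ (hf a) _ (hf b))]
    refine forall₂_congr fun y _ => ?_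
    rw [L.sat_and Θ M y _ (ht a) _ (ht b), L.sat_or Θ M y _ (hf a) _ (hf b), DiagramAxiom.Holds]
    tauto

theorem sat_reduct (L : AbstractLogic.{u, v}) {Θ Θ' : Signature.{u}}
    (h : Θ.letters ⊆ Θ'.letters) (M : Model Θ') (x : M.World) {φ : L.Form}
    (hφ : φ ∈ L.formulas Θ) : L.Sat (M.reduct h) x φ ↔ L.Sat M x φ :=
  (L.expansion Θ Θ' h M x φ hφ).symm

/-- If each finite part of a diagram is realized in a model by an assignment of worlds to the
points, then the whole diagram is realized by a multivalued assignment. -/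
theorem StarCompact.exists_diagram (hComp : L.StarCompact) (hExt : BIL.{u}.IsExtendedBy L)
    {Θ : Signature.{u}} {P : Type*} [Small.{u} P] {Γ Δ : P → Set L.Form}
    (hΓ : ∀ a, Γ a ⊆ L.formulas Θ) (hΔ : ∀ a, Δ a ⊆ L.formulas Θ) (R D : P → P → Prop) (a₀ : P)
    (h : ∀ Γ' Δ' : P → Set L.Form, (∀ a, Γ' a ⊆ Γ a ∧ (Γ' a).Finite) →
      (∀ a, Δ' a ⊆ Δ a ∧ (Δ' a).Finite) →
      ∃ (M : Model Θ) (g : P → M.World), (∀ a, (Γ' a, Δ' a) ≤ L.Th M (g a)) ∧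
        (∀ a b, R a b → M.rel (g a) (g b)) ∧ ∀ a b, D a b → g a ≠ g b) :
    ∃ (K : Model Θ) (k : K.World) (I : P → K.World → Prop), I a₀ k ∧
      (∀ a x, I a x → (Γ a, Δ a) ≤ L.Th K x) ∧
      (∀ a b x, R a b → I a x → ∃ y, K.rel x y ∧ I b y) ∧
      (∀ a b x, R a b → I b x → ∃ y, K.rel y x ∧ I a y) ∧
      ∀ a b x, D a b → I a x → ¬ I b x := by
  obtain ⟨e, he, he'⟩ := Θ.exists_fresh (P × Bool)
  have hsub := Θ.subset_extend e
  have hmem : ∀ i, e i ∈ (Θ.extend e).letters := fun i => Or.inr ⟨i, rfl⟩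
  choose at' hat hsat using fun i => exists_atom hExt (hmem i)
  have hΓ' : ∀ a, Γ a ⊆ L.formulas (Θ.extend e) := fun a => (hΓ a).trans (L.mono _ _ hsub)
  have hΔ' : ∀ a, Δ a ⊆ L.formulas (Θ.extend e) := fun a => (hΔ a).trans (L.mono _ _ hsub)
  let t : P → L.Form := fun a => at' (a, true)
  let f : P → L.Form := fun a => at' (a, false)
  have ht : ∀ a, t a ∈ L.formulas (Θ.extend e) := fun a => hat _
  have hf : ∀ a, f a ∈ L.formulas (Θ.extend e) := fun a => hat _
  obtain ⟨K, k, hk, hk', hK⟩ := hComp.exists_linked (ht a₀) (hf a₀) (diagramAxioms Γ Δ R D)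
    (L.diagramFormula t f) (diagramFormula_mem ht hf hΓ' hΔ') fun S hS hSf => by
      obtain ⟨M, g, hth, hR, hD⟩ := h (fun a => DiagramAxiom.pos a ⁻¹' S)
        (fun a => DiagramAxiom.neg a ⁻¹' S)
        (fun a => ⟨fun φ hφ => hS hφ, Set.Finite.preimage (f := DiagramAxiom.pos a)
          (fun φ _ ψ _ hh => by injection hh) hSf⟩)
        (fun a => ⟨fun φ hφ => hS hφ, Set.Finite.preimage (f := DiagramAxiom.neg a)
          (fun φ _ ψ _ hh => by injection hh) hSf⟩)
      -- The up-set of `g a` and the complement of its down-set are both up-closed. By antisymmetry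
      -- `g a` is the only world in the first and not in the second.
      let V : P × Bool → Set M.World := fun i =>
        if i.2 then {x | M.rel (g i.1) x} else {x | ¬ M.rel x (g i.1)}
      have hV : ∀ i x y, M.rel x y → x ∈ V i → y ∈ V i := by
        rintro ⟨a, _ | _⟩ x y hxy hx
        · exact fun hy => hx (M.rel_trans _ _ _ hxy hy)
        · exact M.rel_trans _ _ _ hx hxy
      have hname : ∀ a (x : (M.expand e V hV).World),
          L.Sat (M.expand e V hV) x (t a) ∧ ¬ L.Sat (M.expand e V hV) x (f a) ↔ g a = x := by
        intro a x
        have h1 := (hsat (a, true) _ x).trans (M.mem_expand_val he he' V hV _ (hmem _) x)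
        have h2 := (hsat (a, false) _ x).trans (M.mem_expand_val he he' V hV _ (hmem _) x)
        refine (and_congr h1 (not_congr h2)).trans ⟨fun h => ?_, ?_⟩
        · exact M.rel_antisymm _ _ h.1 (not_not.1 h.2)
        · rintro rfl
          exact ⟨M.rel_refl _, not_not.2 (M.rel_refl _)⟩
      have hsatM : ∀ φ ∈ L.formulas Θ, ∀ x : M.World,
          L.Sat (M.expand e V hV) x φ ↔ L.Sat M x φ := fun φ hφ x =>
        (L.sat_reduct hsub (M.expand e V hV) x hφ).symm.trans
          (L.isomorphism Θ _ _ (M.expandIso he' V hV) x φ hφ).symm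
      have h0 := (hname a₀ (g a₀)).2 rfl
      refine ⟨M.expand e V hV, g a₀, h0.1, h0.2, fun i hi x => ?_⟩
      rw [sat_diagramFormula ht hf hΓ' hΔ' _ _ i (hS hi)]
      intro y _
      simp only [hname]
      match i, hi with
      | .pos a φ, hi =>
        rintro rfl
        exact (hsatM φ (hΓ a (hS hi)) _).2 ((hth a).1 hi).2
      | .neg a φ, hi =>
        rintro rfl hs
        exact ((hth a).2 hi).2 ((hsatM φ (hΔ a (hS hi)) _).1 hs)
      | .up a b, hi =>
        rintro rfl
        exact ⟨g b, hR a b (hS hi), rfl⟩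
      | .down a b, hi =>
        rintro rfl
        exact ⟨g b, hR b a (hS hi), rfl⟩
      | .ne a b, hi =>
        rintro rfl hb
        exact hD a b (hS hi) hb.symm
  let J : P → K.World → Prop := fun a x => L.Sat K x (t a) ∧ ¬ L.Sat K x (f a)
  have hold : ∀ i ∈ diagramAxioms Γ Δ R D, ∀ x, K.Linked k x → i.Holds L K J x :=
    fun i hi x hx => (sat_diagramFormula ht hf hΓ' hΔ' K x i hi).1 (hK i hi x hx) x (K.rel_refl x)
  -- The axioms are known only in the component of `k`, so names are restricted to it; worlds
  -- supplied by `up` and `down` never leave it.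
  refine ⟨K.reduct hsub, k, fun a x => K.Linked k x ∧ J a x, ⟨.refl, hk, hk'⟩, ?_, ?_, ?_, ?_⟩
  · rintro a x ⟨hx, hax⟩
    refine (L.th_le_iff (hΓ a) (hΔ a)).2 ⟨fun φ hφ => ?_, fun φ hφ => ?_⟩
    · rw [L.sat_reduct hsub K x (hΓ a hφ)]
      exact hold (.pos a φ) hφ x hx hax
    · rw [L.sat_reduct hsub K x (hΔ a hφ)]
      exact hold (.neg a φ) hφ x hx hax
  · rintro a b x hab ⟨hx, hax⟩
    obtain ⟨y, hy, hby⟩ := hold (.up a b) hab x hx hax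
    exact ⟨y, hy, hx.tail (Or.inl hy), hby⟩
  · rintro a b x hab ⟨hx, hax⟩
    obtain ⟨y, hy, hby⟩ := hold (.down b a) hab x hx hax
    exact ⟨y, hy, hx.tail (Or.inr hy), hby⟩
  · rintro a b x hab ⟨hx, hax⟩ ⟨_, hbx⟩
    exact hold (.ne a b) hab x hx hax hbx

end AbstractLogic

/-! ### Bi-unravellings as trees -/

namespace Model

variable {Θ : Signature.{u}}

namespace UnravelWorld

variable {M : Model Θ} {w : M.World}

theorem adjacent_of_eq_append {s t : UnravelWorld M w} {b : M.World} (h : t.1 = s.1 ++ [b]) :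
    M.Adjacent s.last b := by
  have ht := t.2
  rw [h, ← List.cons_append, List.isChain_append] at ht
  exact ht.2.2 s.last (by
    rw [UnravelWorld.last, List.getLast?_eq_some_getLast (List.cons_ne_nil _ _)]
    exact Option.mem_some_self _) b (by simp)

theorem exists_eq_append (s : UnravelWorld M w) {b : M.World} (h : M.Adjacent s.last b) :
    ∃ t : UnravelWorld M w, t.1 = s.1 ++ [b] ∧ t.last = b := by
  have ht : List.IsChain M.Adjacent (w :: (s.1 ++ [b])) := by
    rw [← List.cons_append, List.isChain_append]
    refine ⟨s.2, List.isChain_singleton b, fun x hx y hy => ?_⟩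
    rw [List.getLast?_eq_some_getLast (List.cons_ne_nil _ _), Option.mem_some_iff] at hx
    rw [List.head?_cons, Option.mem_some_iff] at hy
    rw [← hx, ← hy]
    exact h
  exact ⟨⟨_, ht⟩, rfl, (last_append (t := ⟨_, ht⟩) rfl).1⟩

/-- Recursive construction of a map on a bi-unravelling, with an invariant `J` and a condition `E`
on its values at a sequence and at a one-member prolongation of it. -/
theorem exists_tree_map {X : Type*} (J : UnravelWorld M w → X → Prop)
    (E : UnravelWorld M w → UnravelWorld M w → X → X → Prop) {x₀ : X}
    (hroot : J (M.unravelRoot w) x₀)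
    (hstep : ∀ s t b, t.1 = s.1 ++ [b] → ∀ x, J s x → ∃ y, J t y ∧ E s t x y) :
    ∃ g : UnravelWorld M w → X, g (M.unravelRoot w) = x₀ ∧ (∀ s, J s (g s)) ∧
      ∀ s t b, t.1 = s.1 ++ [b] → E s t (g s) (g t) := by
  classical
  choose! next hnext using hstep
  have tail : ∀ {b : M.World} {l : List M.World}, List.IsChain M.Adjacent (w :: (b :: l).reverse) →
      List.IsChain M.Adjacent (w :: l.reverse) := fun {b l} h => by
    rw [List.reverse_cons, ← List.cons_append] at h
    exact h.left_of_append
  -- Prolongation acts at the end of a sequence while list recursion peels off the head, hence the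
  -- reversal.
  let G : (l : List M.World) → List.IsChain M.Adjacent (w :: l.reverse) → X := fun l =>
    List.rec (motive := fun l => List.IsChain M.Adjacent (w :: l.reverse) → X) (fun _ => x₀)
      (fun b l ih h => next ⟨l.reverse, tail h⟩ ⟨(b :: l).reverse, h⟩ b (ih (tail h))) l
  have hG : ∀ l h, J ⟨l.reverse, h⟩ (G l h) := by
    intro l
    induction l with
    | nil => exact fun _ => hroot
    | cons b l ih => exact fun h => (hnext _ _ b (by simp) _ (ih (tail h))).1
  let g : UnravelWorld M w → X := fun s => G s.1.reverse (by rw [List.reverse_reverse]; exact s.2)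
  have hgG : ∀ (s : UnravelWorld M w) l h, s.1 = l.reverse → g s = G l h := by
    rintro ⟨s, hs⟩ l h rfl
    have : ∀ l' h', l' = l → G l' h' = G l h := by rintro _ _ rfl; rfl
    exact this _ _ (List.reverse_reverse l)
  have hgJ : ∀ s, J s (g s) := by
    intro s
    have h : List.IsChain M.Adjacent (w :: s.1.reverse.reverse) := by
      rw [List.reverse_reverse]; exact s.2
    have := hG s.1.reverse h
    have hs : (⟨s.1.reverse.reverse, h⟩ : UnravelWorld M w) = s :=
      Subtype.ext (List.reverse_reverse s.1)
    rwa [hs] at this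
  refine ⟨g, rfl, hgJ, fun s t b hst => ?_⟩
  have hs : s.1 = s.1.reverse.reverse := (List.reverse_reverse _).symm
  have ht : t.1 = (b :: s.1.reverse).reverse := by rw [List.reverse_cons, List.reverse_reverse, hst]
  have hs' : List.IsChain M.Adjacent (w :: s.1.reverse.reverse) := hs ▸ s.2
  have ht' : List.IsChain M.Adjacent (w :: (b :: s.1.reverse).reverse) := ht ▸ t.2
  have hgt : g t = next s t b (g s) := by
    have hs'' : (⟨_, hs'⟩ : UnravelWorld M w) = s := Subtype.ext hs.symm
    have ht'' : (⟨_, ht'⟩ : UnravelWorld M w) = t := Subtype.ext ht.symm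
    rw [hgG t _ ht' ht, hgG s _ hs' hs]
    change next ⟨_, hs'⟩ ⟨_, ht'⟩ b _ = _
    rw [hs'', ht'']
  rw [hgt]
  exact (hnext s t b hst _ (hgJ s)).2

theorem eq_root_or_exists (s : UnravelWorld M w) :
    s = M.unravelRoot w ∨ ∃ (t : UnravelWorld M w) (b : M.World), s.1 = t.1 ++ [b] := by
  obtain ⟨l, hl⟩ := s
  rcases List.eq_nil_or_concat' l with rfl | ⟨l', b, rfl⟩
  · exact Or.inl rfl
  · refine Or.inr ⟨⟨l', ?_⟩, b, rfl⟩
    rw [← List.cons_append] at hl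
    exact hl.left_of_append

theorem rel_of_eq_append {s t : UnravelWorld M w} {b : M.World} (h : t.1 = s.1 ++ [b])
    (hr : M.rel s.last t.last) : (M.unravel w).rel s t :=
  .single (Or.inl ⟨b, h, (last_append h).1 ▸ hr⟩)

theorem rel_of_eq_append' {s t : UnravelWorld M w} {b : M.World} (h : t.1 = s.1 ++ [b])
    (hr : M.rel t.last s.last) : (M.unravel w).rel t s :=
  .single (Or.inr ⟨b, h, (last_append h).1 ▸ hr⟩)

/-- With its dual below, this gives the nontrivial bi-asimulation clauses for `last`. Repetitions
are barred from sequences, so `s` itself serves when `y` is already its last member. -/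
theorem exists_rel_of_rel_last (s : UnravelWorld M w) {y : M.World} (h : M.rel s.last y) :
    ∃ t : UnravelWorld M w, (M.unravel w).rel s t ∧ t.last = y := by
  by_cases hy : s.last = y
  · exact ⟨s, .refl, hy⟩
  · obtain ⟨t, ht, ht'⟩ := s.exists_eq_append ⟨Or.inl h, hy⟩
    exact ⟨t, rel_of_eq_append ht (ht' ▸ h), ht'⟩

theorem exists_rel_of_last_rel (s : UnravelWorld M w) {y : M.World} (h : M.rel y s.last) :
    ∃ t : UnravelWorld M w, (M.unravel w).rel t s ∧ t.last = y := by
  by_cases hy : s.last = y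
  · exact ⟨s, .refl, hy⟩
  · obtain ⟨t, ht, ht'⟩ := s.exists_eq_append ⟨Or.inr h, hy⟩
    exact ⟨t, rel_of_eq_append' ht (ht' ▸ h), ht'⟩

end UnravelWorld

/-- A map between bi-unravellings that commutes with prolongation of sequences and respects the
orientation of prolongations is an order embedding, provided that it is injective. -/
theorem unravel_rel_iff {M K : Model Θ} {w : M.World} {k : K.World}
    {g : UnravelWorld M w → UnravelWorld K k} (hg : Function.Injective g)
    (hroot : g (M.unravelRoot w) = K.unravelRoot k)
    (happ : ∀ s t b, t.1 = s.1 ++ [b] → ∃ c, (g t).1 = (g s).1 ++ [c])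
    (hup : ∀ s t b, t.1 = s.1 ++ [b] → M.rel s.last t.last → K.rel (g s).last (g t).last)
    (hdown : ∀ s t b, t.1 = s.1 ++ [b] → M.rel t.last s.last → K.rel (g t).last (g s).last)
    (s t : UnravelWorld M w) :
    (M.unravel w).rel s t ↔ (K.unravel k).rel (g s) (g t) := by
  constructor
  · refine Relation.ReflTransGen.lift g (fun s t h => ?_) s t
    rcases h with ⟨b, hb, hr⟩ | ⟨b, hb, hr⟩
    · obtain ⟨c, hc⟩ := happ s t b hb
      refine Or.inl ⟨c, hc, ?_⟩
      rw [← (UnravelWorld.last_append hc).1]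
      exact hup s t b hb ((UnravelWorld.last_append hb).1 ▸ hr)
    · obtain ⟨c, hc⟩ := happ t s b hb
      refine Or.inr ⟨c, hc, ?_⟩
      rw [← (UnravelWorld.last_append hc).1]
      exact hdown t s b hb ((UnravelWorld.last_append hb).1 ▸ hr)
  -- Order is reflected by a monotone left inverse `ρ` of `g`. It follows `g` backwards while the
  -- sequence stays in the range of `g`, and stands still afterwards.
  · obtain ⟨ρ, -, hρ, hρE⟩ := UnravelWorld.exists_tree_map (M := K) (w := k)
      (J := fun x s => ∀ s', g s' = x → s' = s)
      (E := fun x y s t => s = t ∨ g s = x ∧ g t = y ∧ ∃ b, t.1 = s.1 ++ [b])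
      (x₀ := M.unravelRoot w) (fun s hs => hg (hs.trans hroot.symm))
      (by
        intro x y b hxy s hs
        -- The range of `g` is closed under initial segments: if `y` lies in it, so does `x`, and
        -- the invariant makes `s` the preimage of `x`.
        by_cases hy : ∃ t, g t = y
        · obtain ⟨t, rfl⟩ := hy
          refine ⟨t, fun s' h => hg h, Or.inr ?_⟩
          rcases t.eq_root_or_exists with rfl | ⟨r, c, hr⟩
          · rw [hroot] at hxy
            exact absurd hxy.symm (by simp [unravelRoot])
          · obtain ⟨d, hd⟩ := happ r t c hr
            have hrx : g r = x := by
              have h := hd.symm.trans hxy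
              exact Subtype.ext (List.append_inj_left' h rfl)
            have := hs r hrx
            subst this
            exact ⟨hrx, rfl, c, hr⟩
        · exact ⟨s, fun s' h => absurd ⟨s', h⟩ hy, Or.inl rfl⟩)
    have hmono : ∀ x y, (K.unravel k).rel x y → (M.unravel w).rel (ρ x) (ρ y) := by
      intro x y hxy
      induction hxy with
      | refl => exact .refl
      | @tail y z _ hyz ih =>
        refine Relation.ReflTransGen.trans ih ?_
        rcases hyz with ⟨b, hb, hr⟩ | ⟨b, hb, hr⟩
        · rcases hρE y z b hb with h | ⟨h1, h2, c, hc⟩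
          · rw [h]
          · refine UnravelWorld.rel_of_eq_append hc ?_
            obtain ⟨hz, hne⟩ := UnravelWorld.last_append hb
            have had := UnravelWorld.adjacent_of_eq_append hc
            rw [← (UnravelWorld.last_append hc).1] at had
            -- The edge in `M` has the orientation of its image: the opposite one would be carried
            -- over to `K`, against antisymmetry.
            refine had.1.resolve_right fun h => hne (K.rel_antisymm _ _ hr ?_)
            have := hdown _ _ c hc h
            rwa [h1, h2, hz] at this
        · rcases hρE z y b hb with h | ⟨h1, h2, c, hc⟩
          · rw [h]
          · refine UnravelWorld.rel_of_eq_append' hc ?_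
            obtain ⟨hz, hne⟩ := UnravelWorld.last_append hb
            have had := UnravelWorld.adjacent_of_eq_append hc
            rw [← (UnravelWorld.last_append hc).1] at had
            refine had.1.resolve_left fun h => hne (K.rel_antisymm _ _ ?_ hr)
            have := hup _ _ c hc h
            rwa [h1, h2, hz] at this
    intro h
    have := hmono _ _ h
    rwa [← hρ (g s) s rfl, ← hρ (g t) t rfl] at this

end Model

/-! ### Theories in bi-unravellings -/

namespace AbstractLogic

variable {L : AbstractLogic.{u, v}}

/-- A world of a bi-unravelling has the theory of the last member of the sequence. -/
theorem PreservedUnderBiasimulations.th_unravel (hPres : L.PreservedUnderBiasimulations)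
    {Θ : Signature.{u}} (M : Model Θ) (w : M.World) (s : (M.unravel w).World) :
    L.Th (M.unravel w) s = L.Th M (Model.UnravelWorld.last s) := by
  -- The graph of `last` and its converse form a bi-asimulation in either direction, which gives
  -- both inclusions of positive theories.
  have h1 : HalfBiasimulation (M.unravel w) M (fun s x => Model.UnravelWorld.last s = x)
      (fun x s => Model.UnravelWorld.last s = x) := by
    constructor
    · rintro s _ p rfl h
      exact h
    · rintro s _ y rfl h
      obtain ⟨t, ht, ht'⟩ := Model.UnravelWorld.exists_rel_of_rel_last s h
      exact ⟨t, ht, ht', ht'⟩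
    · rintro s t _ rfl h
      exact ⟨_, Model.UnravelStep.le_of_reflTransGen h, rfl, rfl⟩
  have h2 : HalfBiasimulation M (M.unravel w) (fun x s => Model.UnravelWorld.last s = x)
      (fun s x => Model.UnravelWorld.last s = x) := by
    constructor
    · rintro _ s p rfl h
      exact h
    · rintro _ s t rfl h
      exact ⟨_, Model.UnravelStep.le_of_reflTransGen h, rfl, rfl⟩
    · rintro _ y s rfl h
      obtain ⟨t, ht, ht'⟩ := Model.UnravelWorld.exists_rel_of_last_rel s h
      exact ⟨t, ht, ht', ht'⟩
  exact L.th_eq_of_fst_eq (Set.Subset.antisymm (hPres Θ _ s _ _ _ _ ⟨rfl, h1, h2⟩)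
    (hPres Θ _ _ _ s _ _ ⟨rfl, h2, h1⟩))

end AbstractLogic

/-! ### Extensions that realize all types -/

namespace AbstractLogic

variable {L : AbstractLogic.{u, v}} {Θ : Signature.{u}}

/-- The successor types of worlds of `M`. -/
def SuccType (L : AbstractLogic.{u, v}) (M : Model Θ) : Type _ :=
  {τ : M.World × Set (L.formulas Θ) × Set (L.formulas Θ) //
    L.IsSuccessorType M τ.1 (Subtype.val '' τ.2.1) (Subtype.val '' τ.2.2)}

/-- The predecessor types of worlds of `M`. -/
def PredType (L : AbstractLogic.{u, v}) (M : Model Θ) : Type _ :=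
  {τ : M.World × Set (L.formulas Θ) × Set (L.formulas Θ) //
    L.IsPredecessorType M τ.1 (Subtype.val '' τ.2.1) (Subtype.val '' τ.2.2)}

/-- The points of the diagram of `M`: its worlds and the required realizations of types. -/
inductive TypePoint (L : AbstractLogic.{u, v}) (M : Model Θ)
  | world (x : M.World)
  | succ (τ : L.SuccType M)
  | pred (τ : L.PredType M)

/-- Fresh letters are available only for a small family of points. Hence types are coded by subsets
of the small `L.formulas Θ`, not of `L.Form`. -/
instance TypePoint.small (M : Model Θ) : Small.{u} (L.TypePoint M) := by
  have := L.formulas_small Θ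
  have h1 : Small.{u} (L.SuccType M) := small_of_injective Subtype.val_injective
  have h2 : Small.{u} (L.PredType M) := small_of_injective Subtype.val_injective
  let f : M.World ⊕ L.SuccType M ⊕ L.PredType M → L.TypePoint M :=
    Sum.elim .world (Sum.elim .succ .pred)
  refine small_of_surjective (f := f) ?_
  rintro (x | τ | τ)
  exacts [⟨.inl x, rfl⟩, ⟨.inr (.inl τ), rfl⟩, ⟨.inr (.inr τ), rfl⟩]

/-- The theory to be realized at a point. -/
def TypePoint.theory {M : Model Θ} : L.TypePoint M → Set L.Form × Set L.Form
  | .world x => L.Th M x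
  | .succ τ => (Subtype.val '' τ.1.2.1, Subtype.val '' τ.1.2.2)
  | .pred τ => (Subtype.val '' τ.1.2.1, Subtype.val '' τ.1.2.2)

/-- The order relations between points. -/
inductive TypePoint.Rel {M : Model Θ} : L.TypePoint M → L.TypePoint M → Prop
  | world {x y : M.World} (h : M.rel x y) : Rel (.world x) (.world y)
  | succ (τ : L.SuccType M) : Rel (.world τ.1.1) (.succ τ)
  | pred (τ : L.PredType M) : Rel (.pred τ) (.world τ.1.1)

/-- Distinctness of points that are worlds. -/
inductive TypePoint.Distinct {M : Model Θ} : L.TypePoint M → L.TypePoint M → Prop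
  | world {x y : M.World} (h : x ≠ y) : Distinct (.world x) (.world y)

theorem TypePoint.theory_subset {M : Model Θ} (a : L.TypePoint M) :
    a.theory.1 ⊆ L.formulas Θ ∧ a.theory.2 ⊆ L.formulas Θ := by
  rcases a with x | τ | τ
  · exact ⟨fun φ h => h.1, fun φ h => h.1⟩
  · exact ⟨τ.2.1, τ.2.2.1⟩
  · exact ⟨τ.2.1, τ.2.2.1⟩

/-- There is a model with a multivalued assignment of worlds to the worlds of `M` that respects
theories and realizes all types of `M`. -/
theorem StarCompact.exists_type_diagram (hComp : L.StarCompact) (hExt : BIL.{u}.IsExtendedBy L)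
    (M : Model Θ) (w : M.World) :
    ∃ (K : Model Θ) (k : K.World) (I : M.World → K.World → Prop), I w k ∧
      (∀ x z, I x z → L.Th M x = L.Th K z) ∧
      (∀ x y z, I x z → I y z → x = y) ∧
      (∀ x y z, M.rel x y → I x z → ∃ z', K.rel z z' ∧ I y z') ∧
      (∀ x y z, M.rel y x → I x z → ∃ z', K.rel z' z ∧ I y z') ∧
      (∀ x z Γ Δ, I x z → L.IsSuccessorType M x Γ Δ → ∃ z', K.rel z z' ∧ (Γ, Δ) ≤ L.Th K z') ∧
      ∀ x z Γ Δ, I x z → L.IsPredecessorType M x Γ Δ → ∃ z', K.rel z' z ∧ (Γ, Δ) ≤ L.Th K z' := by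
  obtain ⟨K, k, I, h0, hth, hup, hdown, hne⟩ := hComp.exists_diagram hExt
    (Γ := fun a : L.TypePoint M => a.theory.1) (Δ := fun a => a.theory.2)
    (fun a => a.theory_subset.1) (fun a => a.theory_subset.2) TypePoint.Rel TypePoint.Distinct
    (.world w) fun Γ' Δ' hΓ' hΔ' => by
      -- A finite part of the diagram holds in `M` itself: worlds stand for themselves, and the
      -- point of a type is sent to a realization of the finite part.
      choose f hf hf' using fun τ : L.SuccType M => τ.2.2.2 _ (hΓ' (.succ τ)).1 _
        (hΔ' (.succ τ)).1 (hΓ' (.succ τ)).2 (hΔ' (.succ τ)).2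
      choose g hg hg' using fun τ : L.PredType M => τ.2.2.2 _ (hΓ' (.pred τ)).1 _
        (hΔ' (.pred τ)).1 (hΓ' (.pred τ)).2 (hΔ' (.pred τ)).2
      refine ⟨M, fun | .world x => x | .succ τ => f τ | .pred τ => g τ, ?_, ?_, ?_⟩
      · rintro (x | τ | τ)
        exacts [⟨(hΓ' (.world x)).1, (hΔ' (.world x)).1⟩, hf' τ, hg' τ]
      · rintro _ _ (h | τ | τ)
        exacts [h, hf τ, hg τ]
      · rintro _ _ ⟨h⟩
        exact h
  refine ⟨K, k, fun x z => I (.world x) z, h0, fun x z h => ?_, fun x y z hx hy => ?_,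
    fun x y z hxy => hup _ _ z (.world hxy), fun x y z hxy => hdown _ _ z (.world hxy),
    fun x z Γ Δ hx ht => ?_, fun x z Γ Δ hx ht => ?_⟩
  -- The theory of `x` decides every formula, so containment of pairs is equality.
  · have := hth (.world x) z h
    refine L.th_eq_iff.2 fun φ hφ => ⟨fun hs => (this.1 ⟨hφ, hs⟩).2, fun hs => ?_⟩
    by_contra hs'
    exact (this.2 ⟨hφ, hs'⟩).2 hs
  · by_contra h
    exact hne _ _ z (.world h) hx hy
  · have hΓ : Subtype.val '' (Subtype.val ⁻¹' Γ : Set (L.formulas Θ)) = Γ := by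
      rw [Subtype.image_preimage_coe, Set.inter_eq_right.2 ht.1]
    have hΔ : Subtype.val '' (Subtype.val ⁻¹' Δ : Set (L.formulas Θ)) = Δ := by
      rw [Subtype.image_preimage_coe, Set.inter_eq_right.2 ht.2.1]
    let τ : L.SuccType M := ⟨(x, Subtype.val ⁻¹' Γ, Subtype.val ⁻¹' Δ), by rwa [hΓ, hΔ]⟩
    obtain ⟨z', hz', hτ⟩ := hup _ _ z (.succ τ) hx
    have := hth _ z' hτ
    exact ⟨z', hz', by rwa [← hΓ, ← hΔ]⟩
  · have hΓ : Subtype.val '' (Subtype.val ⁻¹' Γ : Set (L.formulas Θ)) = Γ := by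
      rw [Subtype.image_preimage_coe, Set.inter_eq_right.2 ht.1]
    have hΔ : Subtype.val '' (Subtype.val ⁻¹' Δ : Set (L.formulas Θ)) = Δ := by
      rw [Subtype.image_preimage_coe, Set.inter_eq_right.2 ht.2.1]
    let τ : L.PredType M := ⟨(x, Subtype.val ⁻¹' Γ, Subtype.val ⁻¹' Δ), by rwa [hΓ, hΔ]⟩
    obtain ⟨z', hz', hτ⟩ := hdown _ _ z (.pred τ) hx
    have := hth _ z' hτ
    exact ⟨z', hz', by rwa [← hΓ, ← hΔ]⟩

/-- Each bi-unravelling is an elementary submodel of a bi-unravelling that realizes its types. -/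
theorem exists_unravel_extension (hExt : BIL.{u}.IsExtendedBy L)
    (hPres : L.PreservedUnderBiasimulations) (hComp : L.StarCompact) (M : Model Θ) (w : M.World) :
    ∃ (K : Model Θ) (k : K.World) (g : (M.unravel w).World → (K.unravel k).World),
      L.ElementarySubmodel (M.unravel w) (K.unravel k) g ∧
      L.RealizesTypesOf (K.unravel k) (M.unravel w) g := by
  obtain ⟨K, k, I, h0, hth, hinj, hup, hdown, hsucc, hpred⟩ :=
    hComp.exists_type_diagram hExt (M.unravel w) (M.unravelRoot w)
  -- The sequence assigned to `s` ends in a world named `s`; each edge of the tree is answered by an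
  -- edge of `K` with the same orientation.
  obtain ⟨g, hroot, hI, hE⟩ := Model.UnravelWorld.exists_tree_map
    (J := fun s (z : Model.UnravelWorld K k) => I s z.last)
    (E := fun s t z z' => (∃ c, z'.1 = z.1 ++ [c]) ∧
      (M.rel s.last t.last → K.rel z.last z'.last) ∧ (M.rel t.last s.last → K.rel z'.last z.last))
    (x₀ := K.unravelRoot k) h0 (by
      intro s t b hst z hz
      have hlt := Model.UnravelWorld.last_append hst
      have hadj := Model.UnravelWorld.adjacent_of_eq_append hst
      rw [← hlt.1] at hadj hlt
      have hst' : s ≠ t := fun h => hlt.2 (h ▸ rfl)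
      -- Distinct worlds never share a bearer, so the next world differs from the present one, as
      -- adjacency requires.
      have hne : ∀ z', I t z' → z.last ≠ z' := by
        rintro _ hz' rfl
        exact hst' (hinj _ _ _ hz hz')
      rcases hadj.1 with hr | hr
      · obtain ⟨c, hc, hc'⟩ := hup s t _ (Model.UnravelWorld.rel_of_eq_append hst hr) hz
        obtain ⟨z', hz', rfl⟩ := z.exists_eq_append ⟨Or.inl hc, hne c hc'⟩
        exact ⟨z', hc', ⟨_, hz'⟩, fun _ => hc, fun h => absurd (M.rel_antisymm _ _ hr h) hadj.2⟩
      · obtain ⟨c, hc, hc'⟩ := hdown s t _ (Model.UnravelWorld.rel_of_eq_append' hst hr) hz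
        obtain ⟨z', hz', rfl⟩ := z.exists_eq_append ⟨Or.inr hc, hne c hc'⟩
        exact ⟨z', hc', ⟨_, hz'⟩, fun h => absurd (M.rel_antisymm _ _ h hr) hadj.2, fun _ => hc⟩)
  have hg : Function.Injective g := fun s t h => hinj s t _ (hI s) (h ▸ hI t)
  have hgth : ∀ s, L.Th (M.unravel w) s = L.Th (K.unravel k) (g s) := fun s =>
    (hth s _ (hI s)).trans (hPres.th_unravel K k (g s)).symm
  refine ⟨K, k, g, ⟨⟨hg, ?_, fun p s => val_iff_of_th_eq hExt (hgth s) p⟩, hgth⟩, ?_⟩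
  · exact Model.unravel_rel_iff hg hroot (fun s t b h => (hE s t b h).1)
      (fun s t b h => (hE s t b h).2.1) (fun s t b h => (hE s t b h).2.2)
  · intro s Γ Δ
    refine ⟨fun ht => ?_, fun ht => ?_⟩
    · obtain ⟨y, hy, hy'⟩ := hsucc s _ Γ Δ (hI s) ht
      obtain ⟨z, hz, rfl⟩ := (g s).exists_rel_of_rel_last hy
      exact ⟨z, hz, by rwa [hPres.th_unravel K k z]⟩
    · obtain ⟨y, hy, hy'⟩ := hpred s _ Γ Δ (hI s) ht
      obtain ⟨z, hz, rfl⟩ := (g s).exists_rel_of_last_rel hy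
      exact ⟨z, hz, by rwa [hPres.th_unravel K k z]⟩

end AbstractLogic

/-! ### Unions of chains of inclusions -/

namespace Model

variable {Θ : Signature.{u}}

theorem IsInclusion.id (M : Model Θ) : M.IsInclusion M id :=
  ⟨Function.injective_id, fun _ _ => Iff.rfl, fun _ _ => Iff.rfl⟩

theorem IsInclusion.comp {M N K : Model Θ} {g : N.World → K.World} {f : M.World → N.World}
    (hg : N.IsInclusion K g) (hf : M.IsInclusion N f) : M.IsInclusion K (g ∘ f) :=
  ⟨hg.injective.comp hf.injective, fun x y => (hf.rel_iff x y).trans (hg.rel_iff _ _),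
    fun p x => (hf.val_iff p x).trans (hg.val_iff p _)⟩

/-- A model is isomorphic to the submodel on the range of an inclusion. -/
noncomputable def IsInclusion.isoRange {M N : Model Θ} {g : M.World → N.World}
    (hg : M.IsInclusion N g) (hne : (Set.range g).Nonempty) :
    M.Iso (N.submodel (Set.range g) hne) :=
  Iso.ofEquiv (Equiv.ofInjective g hg.injective) hg.rel_iff hg.val_iff

/-- Each `ω`-chain of inclusions has a colimit. -/
theorem exists_colimit (N : ℕ → Model Θ) (g : ∀ n, (N n).World → (N (n + 1)).World)
    (hg : ∀ n, (N n).IsInclusion (N (n + 1)) (g n)) :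
    ∃ (U : Model Θ) (ι : ∀ n, (N n).World → U.World), (∀ n, (N n).IsInclusion U (ι n)) ∧
      (∀ n x, ι (n + 1) (g n x) = ι n x) ∧ ∀ y, ∃ n x, ι n x = y := by
  let t : ∀ {n m : ℕ}, n ≤ m → (N n).World → (N m).World := fun h =>
    Nat.leRecOn (C := fun n => (N n).World) h fun {k} => g k
  have t_self : ∀ n x, t (le_refl n) x = x := fun n x =>
    Nat.leRecOn_self (C := fun n => (N n).World) x
  have t_trans : ∀ {n m k} (h : n ≤ m) (h' : m ≤ k) x, t (h.trans h') x = t h' (t h x) :=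
    fun h h' x => Nat.leRecOn_trans (C := fun n => (N n).World) h h' x
  have t_succ : ∀ n x, t (Nat.le_succ n) x = g n x := fun n x =>
    Nat.leRecOn_succ' (C := fun n => (N n).World) x
  have t_incl : ∀ {n m} (h : n ≤ m), (N n).IsInclusion (N m) (t h) := by
    intro n m h
    induction m, h using Nat.le_induction with
    | base => exact (funext (t_self n) : t (le_refl n) = id) ▸ IsInclusion.id _
    | succ m hm ih =>
      have : t (Nat.le_succ_of_le hm) = g m ∘ t hm := funext fun x =>
        Nat.leRecOn_succ (C := fun n => (N n).World) hm x
      exact this ▸ (hg m).comp ih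
  -- Elements are compared at a common stage. The transition maps are inclusions, so the stage does
  -- not matter, and mutual `le` is eventual equality.
  let le : (Σ n, (N n).World) → (Σ n, (N n).World) → Prop := fun a b =>
    (N (max a.1 b.1)).rel (t (le_max_left _ _) a.2) (t (le_max_right _ _) b.2)
  have le_iff : ∀ {a b : Σ n, (N n).World} {m : ℕ} (ha : a.1 ≤ m) (hb : b.1 ≤ m),
      le a b ↔ (N m).rel (t ha a.2) (t hb b.2) := by
    intro a b m ha hb
    refine ((t_incl (max_le ha hb)).rel_iff _ _).trans ?_
    rw [← t_trans, ← t_trans]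
  have le_refl' : ∀ a, le a a := fun a => (N _).rel_refl _
  have le_trans' : ∀ a b c, le a b → le b c → le a c := by
    intro a b c hab hbc
    have ha : a.1 ≤ a.1 + b.1 + c.1 := by omega
    have hb : b.1 ≤ a.1 + b.1 + c.1 := by omega
    have hc : c.1 ≤ a.1 + b.1 + c.1 := by omega
    exact (le_iff ha hc).2 ((N _).rel_trans _ _ _ ((le_iff ha hb).1 hab) ((le_iff hb hc).1 hbc))
  have le_val : ∀ p a b, le a b → a.2 ∈ (N a.1).val p → b.2 ∈ (N b.1).val p := by
    intro p a b hab ha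
    rw [(t_incl (le_max_right a.1 b.1)).val_iff]
    exact (N _).val_mono p _ _ hab (((t_incl (le_max_left a.1 b.1)).val_iff p _).1 ha)
  let s : Setoid (Σ n, (N n).World) :=
    ⟨fun a b => le a b ∧ le b a, fun a => ⟨le_refl' a, le_refl' a⟩, fun h => ⟨h.2, h.1⟩,
      fun h h' => ⟨le_trans' _ _ _ h.1 h'.1, le_trans' _ _ _ h'.2 h.2⟩⟩
  let U : Model Θ :=
    { World := Quotient s
      nonempty := (N 0).nonempty.map fun x => Quotient.mk s ⟨0, x⟩
      rel := Quotient.lift₂ le fun a b a' b' h h' => propext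
        ⟨fun k => le_trans' _ _ _ h.2 (le_trans' _ _ _ k h'.1),
          fun k => le_trans' _ _ _ h.1 (le_trans' _ _ _ k h'.2)⟩
      rel_refl := fun x => Quotient.inductionOn x le_refl'
      rel_trans := fun x y z => Quotient.inductionOn₃ x y z le_trans'
      rel_antisymm := fun x y => Quotient.inductionOn₂ x y fun _ _ h h' => Quotient.sound ⟨h, h'⟩
      val := fun p => {x | Quotient.lift (fun a : Σ n, (N n).World => a.2 ∈ (N a.1).val p)
        (fun a b (h : le a b ∧ le b a) => propext ⟨le_val p a b h.1, le_val p b a h.2⟩) x}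
      val_mono := fun p x y => Quotient.inductionOn₂ x y fun a b h => le_val p a b h }
  have mk_rel : ∀ n (x y : (N n).World), (N n).rel x y ↔ le ⟨n, x⟩ ⟨n, y⟩ := fun n x y =>
    ((le_iff (a := ⟨n, x⟩) (b := ⟨n, y⟩) (le_refl n) (le_refl n)).trans
      (by rw [t_self, t_self])).symm
  refine ⟨U, fun n x => Quotient.mk s ⟨n, x⟩, fun n => ⟨fun x y h => ?_, mk_rel n,
    fun p x => Iff.rfl⟩, fun n x => ?_, fun y => ?_⟩
  · have := Quotient.exact h
    exact (N n).rel_antisymm _ _ ((mk_rel n x y).2 this.1) ((mk_rel n y x).2 this.2)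
  · have : t (le_refl (n + 1)) (g n x) = t (Nat.le_succ n) x := by rw [t_self, t_succ]
    refine Quotient.sound ⟨?_, ?_⟩
    · refine (le_iff (a := ⟨n + 1, g n x⟩) (b := ⟨n, x⟩) (le_refl (n + 1)) (Nat.le_succ n)).2 ?_
      exact this ▸ (N _).rel_refl _
    · refine (le_iff (a := ⟨n, x⟩) (b := ⟨n + 1, g n x⟩) (Nat.le_succ n) (le_refl (n + 1))).2 ?_
      exact this ▸ (N _).rel_refl _
  · exact Quotient.inductionOn y fun a => ⟨a.1, a.2, rfl⟩

end Model

/-! ### Saturation of the union -/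

namespace AbstractLogic

variable {L : AbstractLogic.{u, v}} {Θ : Signature.{u}}

/-- An `ω`-chain of elementary inclusions, each member of which realizes the types of its
predecessor, has a saturated union. -/
theorem TarskiUnionProperty.exists_saturated_union (hTUP : L.TarskiUnionProperty)
    (N : ℕ → Model Θ) (g : ∀ n, (N n).World → (N (n + 1)).World)
    (hg : ∀ n, L.ElementarySubmodel (N n) (N (n + 1)) (g n))
    (hr : ∀ n, L.RealizesTypesOf (N (n + 1)) (N n) (g n)) :
    ∃ (U : Model Θ), L.Saturated U ∧ ∃ (W : ℕ → Set U.World) (h : U.IsUnionOfChain W),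
      Nonempty ((N 0).Iso (U.submodel (W 0) (h.nonempty 0))) ∧
      L.IsUnionOfElementaryChain U W h ∧
      ∀ n, L.RealizesTypesOf (U.submodel (W (n + 1)) (h.nonempty (n + 1)))
        (U.submodel (W n) (h.nonempty n)) (Set.inclusion (h.mono n)) := by
  obtain ⟨U, ι, hι, hιg, hcov⟩ := Model.exists_colimit N g fun n => (hg n).1
  have hU : U.IsUnionOfChain fun n => Set.range (ι n) := by
    refine ⟨fun n => ?_, fun n => ?_, Set.eq_univ_of_forall fun y => ?_⟩
    · have := (N n).nonempty
      exact Set.range_nonempty _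
    · rintro _ ⟨x, rfl⟩
      exact ⟨g n x, hιg n x⟩
    · obtain ⟨n, x, h⟩ := hcov y
      exact Set.mem_iUnion.2 ⟨n, x, h⟩
  let S : ℕ → Model Θ := fun n => U.submodel (Set.range (ι n)) (hU.nonempty n)
  have hth : ∀ n x, L.Th (N n) x = L.Th (S n) ⟨ι n x, x, rfl⟩ := fun n x =>
    L.th_iso ((hι n).isoRange (hU.nonempty n)) x
  have hincl : ∀ n x, Set.inclusion (hU.mono n) ⟨ι n x, x, rfl⟩ = ⟨ι (n + 1) (g n x), _, rfl⟩ :=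
    fun n x => Subtype.ext (hιg n x).symm
  have hchain : L.IsUnionOfElementaryChain U _ hU := by
    refine fun n => ⟨⟨Set.inclusion_injective _, fun _ _ => Iff.rfl, fun _ _ => Iff.rfl⟩, ?_⟩
    rintro ⟨_, x, rfl⟩
    rw [hincl]
    exact (hth n x).symm.trans (((hg n).2 x).trans (hth (n + 1) (g n x)))
  have hreal : ∀ n, L.RealizesTypesOf (S (n + 1)) (S n) (Set.inclusion (hU.mono n)) := by
    rintro n ⟨_, x, rfl⟩ Γ Δ
    refine ⟨fun ht => ?_, fun ht => ?_⟩
    · obtain ⟨y, hy, hy'⟩ := (hr n x Γ Δ).1 (ht.of_th_eq (hth n x))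
      rw [hth] at hy'
      refine ⟨_, ?_, hy'⟩
      rw [hincl]
      exact ((hι (n + 1)).rel_iff _ _).1 hy
    · obtain ⟨y, hy, hy'⟩ := (hr n x Γ Δ).2 (ht.of_th_eq (hth n x))
      rw [hth] at hy'
      refine ⟨_, ?_, hy'⟩
      rw [hincl]
      exact ((hι (n + 1)).rel_iff _ _).1 hy
  have hel := hTUP Θ U _ hU hchain
  refine ⟨U, ?_, _, hU, ⟨(hι 0).isoRange (hU.nonempty 0)⟩, hchain, hreal⟩
  -- A world of `U` appears at some stage `n`, where by TUP it has the same theory and hence the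
  -- same types. These are realized at stage `n + 1`, and TUP carries the realization back to `U`.
  intro y Γ Δ
  obtain ⟨n, x, rfl⟩ := hcov y
  have hx := (hel n).2 ⟨ι n x, x, rfl⟩
  refine ⟨fun ht => ?_, fun ht => ?_⟩
  · obtain ⟨z, hz, hz'⟩ := (hreal n _ Γ Δ).1 (ht.of_th_eq hx)
    exact ⟨z.1, hz, ((hel (n + 1)).2 z) ▸ hz'⟩
  · obtain ⟨z, hz, hz'⟩ := (hreal n _ Γ Δ).2 (ht.of_th_eq hx)
    exact ⟨z.1, hz, ((hel (n + 1)).2 z) ▸ hz'⟩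

end AbstractLogic
end BiInt

theorem mainTheorem2 (L : AbstractLogic.{u, v})
    (hExt : BIL.{u}.IsExtendedBy L)
    (hPres : L.PreservedUnderBiasimulations)
    (hComp : L.StarCompact)
    (hTUP : L.TarskiUnionProperty)
    (Θ : Signature.{u}) (M : Model Θ) (w : M.World) :
    ∃ (N : Model Θ) (w' : N.World),
      L.Th M w = L.Th N w' ∧ L.Saturated N ∧
      ∃ (W : ℕ → Set N.World) (h : N.IsUnionOfChain W)
        (e : (M.unravel w).Iso (N.submodel (W 0) (h.nonempty 0))),
        (e.toFun (M.unravelRoot w)).1 = w' ∧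
        L.IsUnionOfElementaryChain N W h ∧
        ∀ n, L.RealizesTypesOf (N.submodel (W (n + 1)) (h.nonempty (n + 1)))
          (N.submodel (W n) (h.nonempty n)) (Set.inclusion (h.mono n)) := by
  choose K k g hg hr using fun a : Σ M : Model Θ, M.World =>
    AbstractLogic.exists_unravel_extension hExt hPres hComp a.1 a.2
  -- The recursion carries the pointed model to be unravelled, not the unravelling: stage `0` is
  -- then the bi-unravelling of `M` around `w`, and every extension has the shape needed for the
  -- next step.
  let seq : ℕ → Σ M : Model Θ, M.World := fun n => Nat.rec ⟨M, w⟩ (fun _ a => ⟨K a, k a⟩) n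
  obtain ⟨N, hN, W, h, ⟨e⟩, hchain, hreal⟩ := hTUP.exists_saturated_union
    (fun n => (seq n).1.unravel (seq n).2) (fun n => g (seq n)) (fun n => hg (seq n))
    (fun n => hr (seq n))
  refine ⟨N, _, ?_, hN, W, h, e, rfl, hchain, hreal⟩
  exact (hPres.th_unravel M w (M.unravelRoot w)).symm.trans
    ((L.th_iso e _).trans ((hTUP Θ N W h hchain 0).2 _))
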